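/- **Theorem 2.5.** Let $q\in\mathbb C$ with $|q|>1$, fix a logarithm $\log q$ and put $q^{\alpha}=e^{\alpha\log q}$. Write $\sigma_q f(z)=f(qz)$ and, for $|p|>1$, $\Theta_p(z)=\sum_{\ell\in\mathbb Z}p^{-\ell(\ell+1)/2}z^{\ell}$. Let $n_1<n_2$ be integers, $N=n_2-n_1$, let $C_1\in \mathrm{GL}_{m_1}(\mathbb C)$, $C_2\in \mathrm{GL}_{m_2}(\mathbb C)$, let $U$ be an $m_1\times m_2$ matrix with entries in $\sum_{\nu=n_1}^{n_2-1}\mathbb C z^{\nu}$, and put $$D=\begin{pmatrix} z^{n_1}C_1&U\\0&z^{n_2}C_2\end{pmatrix},\qquad A=\begin{pmatrix} z^{n_1}C_1&0\\0&z^{n_2}C_2\end{pmatrix}.$$ For $\lambda\in\mathbb C^*/q^{N^{-1}\mathbb Z}$ let $\mathbb H^{[\lambda]}_{N,N}$ be the set of functions $f$, meromorphic on a punctured neighbourhood of $0$, for which there are $\varepsilon>0$ and a connected open set $\Omega\subset\mathbb C$ containing $\{z\in\mathbb C^*: |z-\lambda q^{\ell}|<\varepsilon|\lambda q^{\ell}|\}$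 for all $\ell\in N^{-1}\mathbb Z$, such that $f$ continues to an analytic function on $\Omega$ with $|f(z)|<L\,|\Theta_{|q|^{1/N}}(M|z|)|$ on $\Omega\setminus\{0\}$ for some constants $L,M>0$. A formal power series is said to belong to $\mathbb H^{[\lambda]}_{N,N}$ if it converges near $0$ and its sum does. Put $$\hat{\mathcal B}_N\Big(\sum_{\ell\ge0} a_\ell z^\ell\Big)=\sum_{\ell\ge0} a_\ell q^{-\ell(\ell-1)/(2N)}\zeta^\ell,\qquad \mathcal L^{[\lambda]}_{N,N}(f)(z)=\sum_{\ell\in N^{-1}\mathbb Z}\frac{f(q^\ell\lambda)}{\Theta_{q^{1/N}}\big(q^{1/N+\ell}\lambda/z\big)}$$ for $f\in\mathbb H^{[\lambda]}_{N,N}$ and $z$ close to $0$ outside $-\lambda q^{N^{-1}\mathbb Z}$. When $\mathcal L^{[\lambda]}_{N,N}(\hat{\mathcal B}_N(\hat h))$ continues to a meromorphic function on $\mathbb C^*$, denote this function by $S_q^{[\lambda]}(\hat h)$; on matrices $S_q^{[\lambda]}$ acts entrywise. Let $$\Sigma=\Big\{\lambda\in\mathbb C^*/q^{N^{-1}\mathbb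 Z}\ :\ \exists\,\alpha_1\in\mathrm{Sp}(C_1),\ \alpha_2\in\mathrm{Sp}(C_2),\ \ \lambda^{N}q^{-\frac{N-1}2}q^{\mathbb Z}=\frac{\alpha_1}{\alpha_2}q^{\mathbb Z}\Big\}.$$ Then $\Sigma$ is finite, and there is a unique formal gauge transformation $\hat H=\begin{pmatrix}\mathrm{Id}&\hat H_{1,2}\\0&\mathrm{Id}\end{pmatrix}$, with $\hat H_{1,2}$ an $m_1\times m_2$ matrix over $\mathbb C[[z]]$, such that $D\hat H=\sigma_q(\hat H)A$. For every $\lambda\in(\mathbb C^*/q^{N^{-1}\mathbb Z})\setminus\Sigma$: 1. the entries of $\hat{\mathcal B}_N(\hat H_{1,2})$ belong to $\mathbb H^{[\lambda]}_{N,N}$; 2. there is a unique matrix $\hat H^{[\lambda]}=\begin{pmatrix}\mathrm{Id}&\hat H^{[\lambda]}_{1,2}\\0&\mathrm{Id}\end{pmatrix}$ with entries meromorphic on $\mathbb C^*$ such that $D\hat H^{[\lambda]}=\sigma_q(\hat H^{[\lambda]})A$ and such that, for $|z|$ close to $0$, the poles of $\hat H^{[\lambda]}_{1,2}$ have order at most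 one and lie on the spiral $-\lambda q^{N^{-1}\mathbb Z}$; the Borel–Laplace sum $S_q^{[\lambda]}(\hat H)$ is well defined, and $$S_q^{[\lambda]}(\hat H)=\hat H^{[\lambda]}.$$ -/

import Mathlib

open Filter Topology

noncomputable section

namespace QBorelLaplace

/-! Throughout, `q` is a complex number with `1 < ‖q‖` and `τ` is the chosen logarithm of `q`
(`Complex.exp τ = q`); it fixes the meaning of `q ^ α` for all complex `α`. -/

/-- The power `q ^ α = exp (α log q)`, where `τ = log q` is the chosen logarithm. -/
def qpow (τ α : ℂ) : ℂ := Complex.exp (α * τ)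

/-- The Theta function `Θ_p(z) = ∑_{l ∈ ℤ} p ^ (-l(l+1)/2) z ^ l`. -/
def theta (p z : ℂ) : ℂ := ∑' l : ℤ, p ^ (-(l * (l + 1) / 2)) * z ^ l

/-- The formal `q`-Borel transformation of order `μ`:
`∑ a_l z ^ l ↦ ∑ a_l q ^ (-l(l-1)/(2μ)) ζ ^ l`. -/
def qBorel (τ : ℂ) (μ : ℚ) (F : PowerSeries ℂ) : PowerSeries ℂ :=
  PowerSeries.mk fun l =>
    PowerSeries.coeff l F * qpow τ (-((l : ℂ) * ((l : ℂ) - 1)) / (2 * (μ : ℂ)))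

/-- The series `F` has a positive radius of convergence and `f` is its sum near `0`. -/
def IsSumNearZero (F : PowerSeries ℂ) (f : ℂ → ℂ) : Prop :=
  ∃ r : ℝ, 0 < r ∧ ∀ z : ℂ, ‖z‖ < r → HasSum (fun k : ℕ => PowerSeries.coeff k F * z ^ k) (f z)

/-- `f` is meromorphic on some punctured neighbourhood of `0`. -/
def MeromorphicNearZero (f : ℂ → ℂ) : Prop :=
  ∃ r : ℝ, 0 < r ∧ MeromorphicOn f {z : ℂ | 0 < ‖z‖ ∧ ‖z‖ < r}

/-- The subgroup `q ^ (K⁻¹ ℤ)` of `ℂˣ`. -/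
def spiralGroup (τ : ℂ) (K : ℕ) : Subgroup ℂˣ :=
  Subgroup.zpowers (Units.mk0 (qpow τ (1 / (K : ℂ))) (Complex.exp_ne_zero _))

/-- The point `q ^ (l / K) * lam` of the discrete spiral `lam q ^ (K⁻¹ ℤ)`. -/
def spiralPoint (τ : ℂ) (K : ℕ) (lam : ℂ) (l : ℤ) : ℂ := qpow τ ((l : ℂ) / (K : ℂ)) * lam

/-- `g` is a continuation of the germ at `0` of the meromorphic function `f` to an analytic
function on a connected domain `Ω` that contains discs of a fixed relative radius `ε` around all
points of the spiral `lam q ^ (K⁻¹ ℤ)`, and `g` has `q ^ (1/μ)`-exponential growth of order `1` on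
`Ω`.  Agreement of `f` and `g` near `0` is agreement of meromorphic functions, that is, up to a
discrete set of points. -/
def IsGrowthContinuation (q τ : ℂ) (μ : ℚ) (K : ℕ) (lam : ℂ) (f g : ℂ → ℂ) : Prop :=
  ∃ (ε : ℝ) (Ω : Set ℂ), 0 < ε ∧ IsOpen Ω ∧ IsConnected Ω ∧
    (∀ (l : ℤ) (z : ℂ), z ≠ 0 →
      ‖z - spiralPoint τ K lam l‖ < ε * ‖spiralPoint τ K lam l‖ → z ∈ Ω) ∧
    DifferentiableOn ℂ g Ω ∧
    (∃ r : ℝ, 0 < r ∧ ∀ w ∈ Ω, 0 < ‖w‖ → ‖w‖ < r → ∀ᶠ z in 𝓝[≠] w, g z = f z) ∧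
    ∃ A M : ℝ, 0 < A ∧ 0 < M ∧ ∀ z ∈ Ω, z ≠ 0 →
      ‖g z‖ < A * ‖theta ((‖q‖ ^ (1 / (μ : ℝ)) : ℝ) : ℂ) ((M * ‖z‖ : ℝ) : ℂ)‖

/-- The space `ℍ_{μ,K}^{[lam]}`, for functions (germs at `0` of meromorphic functions). -/
def MemH (q τ : ℂ) (μ : ℚ) (K : ℕ) (lam : ℂ) (f : ℂ → ℂ) : Prop :=
  MeromorphicNearZero f ∧ ∃ g : ℂ → ℂ, IsGrowthContinuation q τ μ K lam f g

/-- A formal power series belongs to `ℍ_{μ,K}^{[lam]}` if it converges and its sum does. -/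
def SeriesMemH (q τ : ℂ) (μ : ℚ) (K : ℕ) (lam : ℂ) (F : PowerSeries ℂ) : Prop :=
  ∃ f : ℂ → ℂ, IsSumNearZero F f ∧ MemH q τ μ K lam f

/-- For `f` in `ℍ_{μ,K}^{[lam]}`, the function `s` is, near `0`, the `q`-Laplace transform
`(μ/K) ∑_{l ∈ K⁻¹ ℤ} f(q ^ l lam) / Θ_{q^{1/μ}}(q ^ (1/μ + l) lam / z)`; the values
`f(q ^ l lam)` are those of a continuation of `f`, and the series is only considered off the
spiral `-lam q ^ (K⁻¹ ℤ)` of its poles. -/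
def IsQLaplace (q τ : ℂ) (μ : ℚ) (K : ℕ) (lam : ℂ) (f s : ℂ → ℂ) : Prop :=
  MeromorphicNearZero f ∧
  ∃ g : ℂ → ℂ, IsGrowthContinuation q τ μ K lam f g ∧
    ∃ r : ℝ, 0 < r ∧ ∀ z : ℂ, 0 < ‖z‖ → ‖z‖ < r → (∀ l : ℤ, z ≠ -spiralPoint τ K lam l) →
      HasSum
        (fun l : ℤ => ((μ : ℂ) / (K : ℂ)) *
          (g (spiralPoint τ K lam l) /
            theta (qpow τ (1 / (μ : ℂ)))
              (qpow τ (1 / (μ : ℂ) + (l : ℂ) / (K : ℂ)) * lam / z)))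
        (s z)

/-- `s`, a meromorphic function on `ℂ*`, is the one-level Borel--Laplace sum
`ℒ_{μ,K}^{[lam]} (ℬ_μ F)` of the formal power series `F` (whose Borel transform is required to
belong to `ℍ_{μ,K}^{[lam]}`). -/
def IsBorelLaplaceSum (q τ : ℂ) (μ : ℚ) (K : ℕ) (lam : ℂ) (F : PowerSeries ℂ) (s : ℂ → ℂ) :
    Prop :=
  MeromorphicOn s {0}ᶜ ∧
    ∃ f : ℂ → ℂ, IsSumNearZero (qBorel τ μ F) f ∧ IsQLaplace q τ μ K lam f s

/-- The entrywise version of `IsBorelLaplaceSum` for matrices. -/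
def IsMatrixBorelLaplaceSum {ι : Type} (q τ : ℂ) (μ : ℚ) (K : ℕ) (lam : ℂ)
    (H : Matrix ι ι (PowerSeries ℂ)) (S : ℂ → Matrix ι ι ℂ) : Prop :=
  ∀ a b, IsBorelLaplaceSum q τ μ K lam (H a b) (fun z => S z a b)

/-- The block matrix with identity diagonal blocks, upper right block `X` and lower left block
zero. -/
def unip {R : Type} [CommRing R] {m₁ m₂ : ℕ} (X : Matrix (Fin m₁) (Fin m₂) R) :
    Matrix (Fin m₁ ⊕ Fin m₂) (Fin m₁ ⊕ Fin m₂) R :=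
  Matrix.fromBlocks 1 X 0 1

/-- The Birkhoff--Guenther matrix with diagonal blocks `z ^ n₁ C₁`, `z ^ n₂ C₂` and upper right
block `∑_{n₁ ≤ ν < n₂} U_ν z ^ ν`, as a matrix of formal Laurent series. -/
def formalBG {m₁ m₂ : ℕ} (n₁ n₂ : ℤ) (C₁ : Matrix (Fin m₁) (Fin m₁) ℂ)
    (C₂ : Matrix (Fin m₂) (Fin m₂) ℂ) (U : ℤ → Matrix (Fin m₁) (Fin m₂) ℂ) :
    Matrix (Fin m₁ ⊕ Fin m₂) (Fin m₁ ⊕ Fin m₂) (LaurentSeries ℂ) :=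
  Matrix.fromBlocks (C₁.map fun c => HahnSeries.single n₁ c)
    (∑ ν ∈ Finset.Ico n₁ n₂, (U ν).map fun c => HahnSeries.single ν c)
    0 (C₂.map fun c => HahnSeries.single n₂ c)

/-- The value at `z` of the Birkhoff--Guenther matrix. -/
def evalBG {m₁ m₂ : ℕ} (n₁ n₂ : ℤ) (C₁ : Matrix (Fin m₁) (Fin m₁) ℂ)
    (C₂ : Matrix (Fin m₂) (Fin m₂) ℂ) (U : ℤ → Matrix (Fin m₁) (Fin m₂) ℂ) (z : ℂ) :
    Matrix (Fin m₁ ⊕ Fin m₂) (Fin m₁ ⊕ Fin m₂) ℂ :=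
  Matrix.fromBlocks (z ^ n₁ • C₁) (∑ ν ∈ Finset.Ico n₁ n₂, z ^ ν • U ν) 0 (z ^ n₂ • C₂)

/-- The formal gauge transformation `H = unip X` carries the block diagonal system
`A = Diag(z ^ n₁ C₁, z ^ n₂ C₂)` to the Birkhoff--Guenther system `D`:
`D = σ_q(H) A H⁻¹`, written as `D H = σ_q(H) A` (the matrix `H` has determinant one). -/
def IsFormalGauge {m₁ m₂ : ℕ} (q : ℂ) (n₁ n₂ : ℤ) (C₁ : Matrix (Fin m₁) (Fin m₁) ℂ)
    (C₂ : Matrix (Fin m₂) (Fin m₂) ℂ) (U : ℤ → Matrix (Fin m₁) (Fin m₂) ℂ)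
    (X : Matrix (Fin m₁) (Fin m₂) (PowerSeries ℂ)) : Prop :=
  formalBG n₁ n₂ C₁ C₂ U * (unip X).map (HahnSeries.ofPowerSeries ℤ ℂ) =
    ((unip X).map (PowerSeries.rescale q)).map (HahnSeries.ofPowerSeries ℤ ℂ) *
      formalBG n₁ n₂ C₁ C₂ 0

/-- Equality of two matrices of meromorphic functions on `ℂ*`: equality off a discrete subset of
`ℂ*`. -/
def MeroEq {ι κ : Type} (S T : ℂ → Matrix ι κ ℂ) : Prop :=
  ∀ w : ℂ, w ≠ 0 → ∀ᶠ z in 𝓝[≠] w, S z = T z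

/-- `unip X` is a meromorphic gauge transformation attached to `lam`: its entries are meromorphic
on `ℂ*`, it satisfies `D H = σ_q(H) A`, and for `z` close to `0` the poles of `X` have order at
most one and lie on the spiral `-lam q ^ (K⁻¹ ℤ)`. -/
structure IsMeromorphicGauge {m₁ m₂ : ℕ} (q τ : ℂ) (n₁ n₂ : ℤ)
    (C₁ : Matrix (Fin m₁) (Fin m₁) ℂ) (C₂ : Matrix (Fin m₂) (Fin m₂) ℂ)
    (U : ℤ → Matrix (Fin m₁) (Fin m₂) ℂ) (K : ℕ) (lam : ℂ)
    (X : ℂ → Matrix (Fin m₁) (Fin m₂) ℂ) : Prop where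
  meromorphic : ∀ i j, MeromorphicOn (fun z => X z i j) {0}ᶜ
  equation : MeroEq (fun z => evalBG n₁ n₂ C₁ C₂ U z * unip (X z))
    (fun z => unip (X (q * z)) * evalBG n₁ n₂ C₁ C₂ 0 z)
  poles : ∃ r : ℝ, 0 < r ∧ ∀ w : ℂ, 0 < ‖w‖ → ‖w‖ < r → ∀ i j,
    (-1 : ℤ) ≤ meromorphicOrderAt (fun z => X z i j) w ∧
    ((∀ l : ℤ, w ≠ -spiralPoint τ K lam l) → 0 ≤ meromorphicOrderAt (fun z => X z i j) w)

/-- The exceptional set `Σ` in `ℂ* / q ^ (N⁻¹ ℤ)`, `N = n₂ - n₁`: the classes of those `lam` with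
`lam ^ N q ^ (-(N-1)/2) q ^ ℤ = (α₁ / α₂) q ^ ℤ` for eigenvalues `α₁` of `C₁` and `α₂` of `C₂`. -/
def exceptionalSet {m₁ m₂ : ℕ} (q τ : ℂ) (N : ℕ)
    (C₁ : Matrix (Fin m₁) (Fin m₁) ℂ) (C₂ : Matrix (Fin m₂) (Fin m₂) ℂ) :
    Set (ℂˣ ⧸ spiralGroup τ N) :=
  {c | ∃ lam : ℂˣ, (QuotientGroup.mk lam : ℂˣ ⧸ spiralGroup τ N) = c ∧
    ∃ α₁ ∈ spectrum ℂ C₁, ∃ α₂ ∈ spectrum ℂ C₂, ∃ k : ℤ,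
      (lam : ℂ) ^ N * qpow τ (-((N : ℂ) - 1) / 2) = α₁ / α₂ * q ^ k}

end QBorelLaplace

end

open QBorelLaplace

namespace QBorelLaplace

open scoped Matrix Kronecker

/-! Put `p = q^(1/N)`. Since `n₂ = n₁ + N`, the upper right block of the gauge equation, divided by
`z^n₁ C₁` and vectorized, reads `x(z) = ∑_{l<N} z^l h_l + z^N Φ x(q z)` with `Φ = C₂ᵀ ⊗ C₁⁻¹`, whose
eigenvalues are the quotients `α₂ / α₁`. On power series this is the recursion `h_{l+N} = q^l Φ
h_l`, which has exactly one solution (`isFormalGauge_iff_eq`).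

The Borel transform replaces `h_l` by `b_l = p^(-l(l-1)/2) h_l`. The quadratic exponent absorbs the
factor `q^l`, leaving the constant recursion `b_{l+N} = κ Φ b_l` with `κ = p^(-N(N-1)/2) =
q^(-(N-1)/2)` (`borel_gaugeCoeff_add`). Hence the Borel transform is the rational function `(1 - ζ^N
κ Φ)⁻¹ ∑_{l<N} ζ^l b_l`. It is bounded at infinity because `Φ` is invertible, and its poles satisfy
`ζ^N κ = α₁ / α₂`. A spiral outside `Σ` therefore meets no pole (`resolventDen_conjMatrix_ne_zero`),
and a connected domain around the spiral that keeps a fixed distance from the poles gives membership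
in `ℍ`.

With `w = z / lam`, the functional equation of Theta gives all terms of the Laplace sum the common
denominator `Θ_p(w)`: the sum is `∑ f(p^l lam) p^(-l(l+1)/2) w^l / Θ_p(w)`. Inserting the equation
of the Borel transform at the points `p^l lam` turns multiplication by `ζ^j` into `w ↦ p^j w`, and
`Θ_p(p^j w) = p^(j(j-1)/2) w^j Θ_p(w)` restores the original equation (`laplaceResolvent_eq`). The
poles are simple and lie on `-lam p^ℤ` because the zeros of Theta are simple and equal to `-p^ℤ`, by
the Jacobi product.

For uniqueness, the difference `Y` of two solutions satisfies `Y(z) = z^N Φ Y(q z)`. The product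
`V(z) = Θ_p(z / lam) Y(z)` has no poles near `0` and satisfies `V(z) = κ lam^N Φ V(q z)`, so its
`k`-th Laurent coefficient is fixed by `κ (p^k lam)^N Φ`. The condition `lam ∉ Σ` excludes the
eigenvalue `1`, and `V = 0` (`eventually_eq_zero_of_homogeneous`). -/

/-! ### Laurent coefficients on circles -/

/-- The `k`-th Laurent coefficient of `f`, computed on the circle of radius `r`. -/
noncomputable def laurentCoeff (f : ℂ → ℂ) (r : ℝ) (k : ℤ) : ℂ :=
  Real.circleAverage (fun z => f z * z ^ (-k)) 0 r

/-- Multiplication by `q` scales the circle by `‖q‖` and rotates it by `arg q`; the average does not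
see the rotation. -/
theorem circleAverage_comp_mul (f : ℂ → ℂ) (q : ℂ) (r : ℝ) :
    Real.circleAverage (fun z => f (q * z)) 0 r = Real.circleAverage f 0 (‖q‖ * r) := by
  rw [Real.circleAverage_eq_integral_add (R := ‖q‖ * r) q.arg, Real.circleAverage_def]
  congr 1
  refine intervalIntegral.integral_congr fun θ _ => ?_
  have h : q * circleMap 0 r θ = circleMap 0 (‖q‖ * r) (θ + q.arg) := by
    simp only [circleMap, zero_add]
    push_cast
    rw [add_mul, Complex.exp_add]
    conv_lhs => rw [← Complex.norm_mul_exp_arg_mul_I q]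
    ring
  simp only [h]

theorem laurentCoeff_comp_mul (f : ℂ → ℂ) {q : ℂ} (hq : q ≠ 0) (r : ℝ) (k : ℤ) :
    laurentCoeff (fun z => f (q * z)) r k = q ^ k * laurentCoeff f (‖q‖ * r) k := by
  have h1 : (fun z : ℂ => f (q * z) * z ^ (-k)) =
      fun z => q ^ k • ((fun w => f w * w ^ (-k)) (q * z)) := by
    funext z
    rw [smul_eq_mul]
    simp only [mul_zpow, zpow_neg]
    field_simp
  rw [laurentCoeff, h1, Real.circleAverage_fun_smul,
    circleAverage_comp_mul (fun w => f w * w ^ (-k)) q, smul_eq_mul, laurentCoeff]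

/-- The average is `(2πi)⁻¹ ∮ f(z) dz / z`, so Cauchy's theorem on the annulus applies. -/
theorem circleAverage_eq_of_differentiableOn {f : ℂ → ℂ} {R r s : ℝ} (hr : 0 < r) (hrs : r ≤ s)
    (hs : s < R) (hf : DifferentiableOn ℂ f {z | 0 < ‖z‖ ∧ ‖z‖ < R}) :
    Real.circleAverage f 0 r = Real.circleAverage f 0 s := by
  have hopen : IsOpen {z : ℂ | 0 < ‖z‖ ∧ ‖z‖ < R} :=
    (isOpen_lt continuous_const continuous_norm).inter (isOpen_lt continuous_norm continuous_const)
  rw [Real.circleAverage_eq_circleIntegral hr.ne',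
    Real.circleAverage_eq_circleIntegral (hr.trans_le hrs).ne']
  congr 1
  refine (Complex.circleIntegral_sub_center_inv_smul_eq_of_differentiable_on_annulus_off_countable
    hr hrs Set.countable_empty ?_ ?_).symm
  · refine hf.continuousOn.mono fun z hz => ?_
    simp only [Set.mem_sdiff, Metric.mem_closedBall, dist_zero_right, Metric.mem_ball, not_lt] at hz
    exact ⟨hr.trans_le hz.2, hz.1.trans_lt hs⟩
  · intro z hz
    simp only [Set.mem_sdiff, Metric.mem_closedBall, dist_zero_right, Metric.mem_ball, not_le] at hz
    exact hf.differentiableAt (hopen.mem_nhds ⟨hr.trans hz.1.2, hz.1.1.trans hs⟩)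

theorem laurentCoeff_eq_of_differentiableOn {f : ℂ → ℂ} {R r s : ℝ} (hr : 0 < r) (hrs : r ≤ s)
    (hs : s < R) (hf : DifferentiableOn ℂ f {z | 0 < ‖z‖ ∧ ‖z‖ < R}) (k : ℤ) :
    laurentCoeff f r k = laurentCoeff f s k := by
  refine circleAverage_eq_of_differentiableOn hr hrs hs (hf.mul fun z hz => ?_)
  exact (differentiableAt_zpow.mpr (Or.inl (norm_pos_iff.mp hz.1))).differentiableWithinAt

/-- A function that is continuous on a circle is the sum of its Laurent series there, as soon as
this series converges absolutely. -/
theorem hasSum_laurentCoeff {f : ℂ → ℂ} {r : ℝ} (hr : 0 < r)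
    (hf : ContinuousOn f (Metric.sphere 0 r))
    (hs : Summable fun k : ℤ => laurentCoeff f r k * (r : ℂ) ^ k) {z : ℂ} (hz : ‖z‖ = r) :
    HasSum (fun k : ℤ => laurentCoeff f r k * z ^ k) (f z) := by
  have : Fact (0 < 2 * Real.pi) := ⟨Real.two_pi_pos⟩
  have hr' : (r : ℂ) ≠ 0 := by exact_mod_cast hr.ne'
  have hcirc (x : ℝ) : ((AddCircle.toCircle (x : AddCircle (2 * Real.pi)) : Circle) : ℂ) =
      Complex.exp (x * Complex.I) := by
    rw [AddCircle.toCircle_apply_mk, div_self Real.two_pi_pos.ne', one_mul, Circle.coe_exp]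
  -- The restriction of `f` to the circle, as a periodic function: its Fourier coefficients are the
  -- Laurent coefficients times `r ^ k`.
  let F : C(AddCircle (2 * Real.pi), ℂ) :=
    ⟨fun x => f (r * (AddCircle.toCircle x : ℂ)), by
      refine hf.comp_continuous ?_ ?_
      · exact continuous_const.mul (continuous_subtype_val.comp AddCircle.continuous_toCircle)
      · intro x; simp [abs_of_pos hr, Circle.norm_coe]⟩
  have hFc (x : ℝ) : F (x : AddCircle (2 * Real.pi)) = f (circleMap 0 r x) := by
    simp only [F, ContinuousMap.coe_mk, hcirc, circleMap, zero_add]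
  have hcoef (k : ℤ) : fourierCoeff F k = laurentCoeff f r k * (r : ℂ) ^ k := by
    rw [fourierCoeff_eq_intervalIntegral _ _ 0, laurentCoeff, Real.circleAverage_def, zero_add,
      ← one_div, smul_mul_assoc]
    congr 1
    rw [mul_comm _ ((r : ℂ) ^ k), ← intervalIntegral.integral_const_mul]
    refine intervalIntegral.integral_congr fun θ _ => ?_
    simp only [hFc, fourier_coe_apply, smul_eq_mul]
    have h1 : Complex.exp (2 * Real.pi * Complex.I * (-k : ℤ) * θ / (2 * Real.pi : ℝ)) =
        Complex.exp (θ * Complex.I) ^ (-k) := by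
      rw [← Complex.exp_int_mul]
      congr 1
      have : (Real.pi : ℂ) ≠ 0 := by exact_mod_cast Real.pi_ne_zero
      push_cast
      field_simp
    rw [h1]
    simp only [circleMap, zero_add, mul_zpow, zpow_neg]
    field_simp
  have hsum : Summable (fourierCoeff F) := by
    simpa only [funext hcoef] using hs
  have hz0 : z = circleMap 0 r z.arg := by
    simp only [circleMap, zero_add, ← hz, Complex.norm_mul_exp_arg_mul_I]
  have h := has_pointwise_sum_fourier_series_of_summable hsum (z.arg : AddCircle (2 * Real.pi))
  rw [hFc, ← hz0] at h
  convert h using 2 with k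
  rw [hcoef, smul_eq_mul, fourier_coe_apply, mul_assoc]
  congr 1
  have h1 : Complex.exp (2 * Real.pi * Complex.I * k * z.arg / (2 * Real.pi : ℝ)) =
      Complex.exp (z.arg * Complex.I) ^ k := by
    rw [← Complex.exp_int_mul]
    congr 1
    have : (Real.pi : ℂ) ≠ 0 := by exact_mod_cast Real.pi_ne_zero
    push_cast
    field_simp
  rw [h1, ← mul_zpow, ← hz, Complex.norm_mul_exp_arg_mul_I]

/-- The zero series converges absolutely, so Fourier inversion needs no decay estimate here. -/
theorem eq_zero_of_laurentCoeff_eq_zero {f : ℂ → ℂ} {r : ℝ} (hr : 0 < r)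
    (hf : ContinuousOn f (Metric.sphere 0 r)) (h : ∀ k, laurentCoeff f r k = 0) {z : ℂ}
    (hz : ‖z‖ = r) : f z = 0 := by
  have := hasSum_laurentCoeff hr hf (by simp [h, summable_zero]) hz
  simp only [h, zero_mul] at this
  exact this.unique hasSum_zero

/-! ### Theta series -/

/-- The triangular number `l (l + 1) / 2`. -/
def tri (l : ℤ) : ℤ := l * (l + 1) / 2

theorem tri_add_one (l : ℤ) : tri (l + 1) = tri l + (l + 1) := by
  have : (l + 1) * (l + 1 + 1) = l * (l + 1) + (l + 1) * 2 := by ring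
  rw [tri, this, Int.add_mul_ediv_right _ _ two_ne_zero, tri]

theorem tri_neg_add_one (l : ℤ) : tri (-(l + 1)) = tri l := by
  rw [tri, tri]
  congr 1
  ring

theorem tri_zero : tri 0 = 0 := rfl

theorem two_mul_tri (l : ℤ) : 2 * tri l = l * (l + 1) := by
  rw [tri, Int.mul_ediv_cancel' (Int.even_mul_succ_self l).two_dvd]

theorem summable_tri_nat {r x : ℝ} (hr : 1 < r) (hx : 0 < x) :
    Summable fun n : ℕ => r ^ (-tri n) * x ^ (n : ℤ) := by
  have hr0 : 0 < r := one_pos.trans hr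
  refine summable_of_ratio_test_tendsto_lt_one zero_lt_one
    (Eventually.of_forall fun n => by positivity) ?_
  have h (n : ℕ) : ‖r ^ (-tri (n + 1 : ℕ)) * x ^ ((n + 1 : ℕ) : ℤ)‖ / ‖r ^ (-tri n) * x ^ (n : ℤ)‖
      = x * (r⁻¹) ^ (n + 1) := by
    rw [Real.norm_of_nonneg (by positivity), Real.norm_of_nonneg (by positivity)]
    push_cast
    rw [tri_add_one, neg_add, zpow_add₀ hr0.ne', zpow_add_one₀ hx.ne', inv_pow, ← zpow_natCast,
      ← zpow_neg]
    push_cast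
    have : r ^ (-tri n) ≠ 0 := by positivity
    field_simp
  simp only [h]
  have := (tendsto_pow_atTop_nhds_zero_of_lt_one (by positivity) (inv_lt_one_of_one_lt₀ hr)).comp
    (tendsto_add_atTop_nat 1)
  simpa using this.const_mul x

/-- The symmetry `l ↦ -l-1` of the triangular numbers turns the negative half into a one-sided
series in `x⁻¹`. -/
theorem summable_tri {r x : ℝ} (hr : 1 < r) (hx : 0 < x) :
    Summable fun l : ℤ => r ^ (-tri l) * x ^ l := by
  refine Summable.of_nat_of_neg_add_one (summable_tri_nat hr hx) ?_
  refine ((summable_tri_nat hr (inv_pos.mpr hx)).mul_left x⁻¹).congr fun n => ?_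
  rw [tri_neg_add_one, zpow_neg x, zpow_add_one₀ hx.ne', mul_inv, inv_zpow]
  ring

/-- The series `∑ b_l p ^ (-l(l+1)/2) w ^ l`. -/
noncomputable def thetaSeries (b : ℤ → ℂ) (p w : ℂ) : ℂ := ∑' l : ℤ, b l * (p ^ (-tri l) * w ^ l)

theorem theta_eq_thetaSeries (p w : ℂ) : theta p w = thetaSeries (fun _ => 1) p w := by
  simp only [theta, thetaSeries, one_mul, tri]

theorem summable_thetaSeries {b : ℤ → ℂ} {C : ℝ} (hb : ∀ l, ‖b l‖ ≤ C) {p : ℂ} (hp : 1 < ‖p‖)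
    {w : ℂ} (hw : w ≠ 0) : Summable fun l : ℤ => b l * (p ^ (-tri l) * w ^ l) := by
  refine Summable.of_norm_bounded ((summable_tri hp (norm_pos_iff.mpr hw)).mul_left C) fun l => ?_
  rw [norm_mul, norm_mul, norm_zpow, norm_zpow]
  exact mul_le_mul_of_nonneg_right (hb l) (by positivity)

theorem hasSum_thetaSeries {b : ℤ → ℂ} {C : ℝ} (hb : ∀ l, ‖b l‖ ≤ C) {p : ℂ} (hp : 1 < ‖p‖)
    {w : ℂ} (hw : w ≠ 0) :
    HasSum (fun l : ℤ => b l * (p ^ (-tri l) * w ^ l)) (thetaSeries b p w) :=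
  (summable_thetaSeries hb hp hw).hasSum

/-- A majorant on an annulus that is uniform in the sign of `l`, for the M-test applied to
Laurent-type series. -/
theorem zpow_le_add_zpow {a x b : ℝ} (ha : 0 < a) (hax : a ≤ x) (hxb : x ≤ b) (l : ℤ) :
    x ^ l ≤ a ^ l + b ^ l := by
  have hx : 0 < x := ha.trans_le hax
  have hb : 0 < b := hx.trans_le hxb
  rcases le_total 0 l with h | h
  · exact (zpow_le_zpow_left₀ h hx.le hxb).trans (le_add_of_nonneg_left (by positivity))
  · refine le_trans ?_ (le_add_of_nonneg_right (by positivity))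
    obtain ⟨n, rfl⟩ := Int.eq_ofNat_of_zero_le (neg_nonneg.mpr h) |>.imp fun n hn => neg_eq_iff_eq_neg.mp hn
    simp only [zpow_neg, zpow_natCast]
    exact inv_anti₀ (by positivity) (pow_le_pow_left₀ ha.le hax n)

theorem differentiableAt_thetaSeries {b : ℤ → ℂ} {C : ℝ} (hb : ∀ l, ‖b l‖ ≤ C) {p : ℂ}
    (hp : 1 < ‖p‖) {w : ℂ} (hw : w ≠ 0) : DifferentiableAt ℂ (thetaSeries b p) w := by
  have hw' : 0 < ‖w‖ := norm_pos_iff.mpr hw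
  have hopen : IsOpen {z : ℂ | ‖w‖ / 2 < ‖z‖ ∧ ‖z‖ < 2 * ‖w‖} :=
    (isOpen_lt continuous_const continuous_norm).inter (isOpen_lt continuous_norm continuous_const)
  have hC : 0 ≤ C := (norm_nonneg _).trans (hb 0)
  have := Complex.differentiableOn_tsum_of_summable_norm (U := {z : ℂ | ‖w‖ / 2 < ‖z‖ ∧ ‖z‖ < 2 * ‖w‖})
    (F := fun (l : ℤ) z => b l * (p ^ (-tri l) * z ^ l))
    (((summable_tri hp (half_pos hw')).add (summable_tri hp (mul_pos two_pos hw'))).mul_left C)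
    (fun l z hz => ?_) hopen ?_
  · exact this.differentiableAt (hopen.mem_nhds ⟨by linarith, by linarith⟩)
  · have : z ≠ 0 := norm_pos_iff.mp ((half_pos hw').trans hz.1)
    exact (((differentiableAt_zpow.mpr (Or.inl this)).const_mul _).const_mul _).differentiableWithinAt
  · intro l z hz
    rw [norm_mul, norm_mul, norm_zpow, norm_zpow, ← mul_add]
    gcongr
    · exact hb l
    · exact zpow_le_add_zpow (half_pos hw') hz.1.le hz.2.le l

/-! ### Functional equations of Theta and the Euler product -/

section Theta

variable {p : ℂ}

theorem ne_zero_of_one_lt_norm (hp : 1 < ‖p‖) : p ≠ 0 := norm_pos_iff.mp (one_pos.trans hp)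

theorem hasSum_theta (hp : 1 < ‖p‖) {w : ℂ} (hw : w ≠ 0) :
    HasSum (fun l : ℤ => p ^ (-tri l) * w ^ l) (theta p w) := by
  have := hasSum_thetaSeries (b := fun _ => 1) (C := 1) (by simp) hp hw
  simpa only [one_mul, ← theta_eq_thetaSeries] using this

theorem differentiableAt_theta (hp : 1 < ‖p‖) {w : ℂ} (hw : w ≠ 0) :
    DifferentiableAt ℂ (theta p) w := by
  rw [funext (theta_eq_thetaSeries p)]
  exact differentiableAt_thetaSeries (C := 1) (by simp) hp hw

/-- Shift the summation index by one. -/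
theorem theta_mul (hp : 1 < ‖p‖) {w : ℂ} (hw : w ≠ 0) : theta p (p * w) = w * theta p w := by
  have hp0 := ne_zero_of_one_lt_norm hp
  refine (hasSum_theta hp (mul_ne_zero hp0 hw)).unique ?_
  rw [← (Equiv.addRight (1 : ℤ)).hasSum_iff]
  refine ((hasSum_theta hp hw).mul_left w).congr_fun fun l => ?_
  simp only [Function.comp, Equiv.coe_addRight, tri_add_one, mul_zpow, zpow_add_one₀ hw, neg_add]
  rw [zpow_add₀ hp0, ← neg_add, zpow_neg]
  have : p ^ (l + 1) ≠ 0 := zpow_ne_zero _ hp0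
  field_simp
  rw [← zpow_add₀ hp0, neg_add_cancel, zpow_zero]

/-- Reflect the summation index by `l ↦ -l-1`, which preserves `tri`. -/
theorem theta_inv (hp : 1 < ‖p‖) {w : ℂ} (hw : w ≠ 0) : theta p w⁻¹ = w * theta p w := by
  have hp0 := ne_zero_of_one_lt_norm hp
  refine (hasSum_theta hp (inv_ne_zero hw)).unique ?_
  rw [← ((Equiv.addRight (1 : ℤ)).trans (Equiv.neg ℤ)).hasSum_iff]
  refine ((hasSum_theta hp hw).mul_left w).congr_fun fun l => ?_
  simp only [Function.comp, Equiv.trans_apply, Equiv.coe_addRight, Equiv.neg_apply, tri_neg_add_one,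
    inv_zpow, zpow_neg, inv_inv, zpow_add_one₀ hw]
  ring

/-- Iterating `theta_mul` for `k ≥ 0` collects the factors `p^j w`, `0 ≤ j ≤ k`. The shift `k + 1`
makes the exponent exactly `tri k` and matches the argument `q^(1/N + l/N)` of the Laplace kernel.
-/
theorem theta_zpow_mul (hp : 1 < ‖p‖) (k : ℤ) {w : ℂ} (hw : w ≠ 0) :
    theta p (p ^ (k + 1) * w) = p ^ tri k * w ^ (k + 1) * theta p w := by
  have hp0 := ne_zero_of_one_lt_norm hp
  have step (k : ℤ) : theta p (p ^ (k + 1 + 1) * w) = p ^ (k + 1) * w * theta p (p ^ (k + 1) * w) := by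
    rw [zpow_add_one₀ hp0 (k + 1), mul_comm _ p, mul_assoc,
      theta_mul hp (mul_ne_zero (zpow_ne_zero _ hp0) hw)]
  induction k using Int.induction_on with
  | zero => simp [tri_zero, theta_mul hp hw]
  | succ k ih =>
    rw [step, ih, tri_add_one, zpow_add₀ hp0 (tri k), zpow_add_one₀ hw (k + 1)]
    ring
  | pred k ih =>
    have h := step (-k - 1)
    rw [sub_add_cancel] at h
    have ht := tri_add_one (-k - 1)
    rw [sub_add_cancel] at ht
    rw [h, ht, zpow_add₀ hp0, zpow_add_one₀ hw (-k)] at ih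
    have h1 : p ^ (-k : ℤ) * w ≠ 0 := mul_ne_zero (zpow_ne_zero _ hp0) hw
    rw [sub_add_cancel]
    refine mul_left_cancel₀ h1 (ih.trans ?_)
    ring

/-- The product `∏ (1 + v p ^ (-n))` over `n ≥ 1`. -/
noncomputable def eulerProd (p v : ℂ) : ℂ := ∏' n : ℕ, (1 + v * (p⁻¹) ^ (n + 1))

theorem summable_eulerProd (hp : 1 < ‖p‖) (v : ℂ) :
    Summable fun n : ℕ => ‖v * (p⁻¹) ^ (n + 1)‖ := by
  simp only [norm_mul, norm_pow]
  refine ((summable_nat_add_iff 1).mpr (summable_geometric_of_lt_one (norm_nonneg _) ?_)).mul_left _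
  rw [norm_inv]
  exact inv_lt_one_of_one_lt₀ hp

theorem differentiable_eulerProd (hp : 1 < ‖p‖) : Differentiable ℂ (eulerProd p) := by
  intro v
  have hs := summable_eulerProd hp ((‖v‖ + 1 : ℝ) : ℂ)
  have h : HasProdLocallyUniformlyOn (fun (n : ℕ) (v : ℂ) => 1 + v * (p⁻¹) ^ (n + 1))
      (fun v => ∏' n : ℕ, (1 + v * (p⁻¹) ^ (n + 1))) (Metric.ball 0 (‖v‖ + 1)) := by
    refine Summable.hasProdLocallyUniformlyOn_nat_one_add Metric.isOpen_ball
      hs (Eventually.of_forall fun n x hx => ?_)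
      fun n => by fun_prop
    rw [norm_mul, norm_mul]
    gcongr
    rw [Complex.norm_real, Real.norm_of_nonneg (by positivity)]
    exact (mem_ball_zero_iff.mp hx).le
  have hd : DifferentiableOn ℂ (fun v => ∏' n : ℕ, (1 + v * (p⁻¹) ^ (n + 1)))
      (Metric.ball 0 (‖v‖ + 1)) := by
    refine h.differentiableOn (.of_forall fun s => ?_) Metric.isOpen_ball
    exact DifferentiableOn.fun_finsetProd fun n _ => by fun_prop
  exact hd.differentiableAt (Metric.isOpen_ball.mem_nhds (by simp))

/-- Replacing `v` by `p v` moves every factor one place and adds the new first factor `1 + v`. -/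
theorem eulerProd_mul (hp : 1 < ‖p‖) (v : ℂ) : eulerProd p (p * v) = (1 + v) * eulerProd p v := by
  have hp0 := ne_zero_of_one_lt_norm hp
  have h1 (n : ℕ) : 1 + p * v * (p⁻¹) ^ (n + 1) = 1 + v * (p⁻¹) ^ n := by
    rw [pow_succ]
    field_simp
  simp only [eulerProd, h1]
  have hm := multipliable_one_add_of_summable (summable_eulerProd hp v)
  rw [tprod_eq_zero_mul' (f := fun n : ℕ => 1 + v * (p⁻¹) ^ n) hm, pow_zero, mul_one]

theorem exists_zpow_of_eulerProd_eq_zero (hp : 1 < ‖p‖) {v : ℂ} (h : eulerProd p v = 0) :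
    ∃ n : ℕ, v = -p ^ (n + 1) := by
  by_contra! hne
  refine tprod_one_add_ne_zero_of_summable (fun n h0 => hne n ?_) (summable_eulerProd hp v) h
  have hp0 : p ^ (n + 1) ≠ 0 := pow_ne_zero _ (ne_zero_of_one_lt_norm hp)
  rw [inv_pow] at h0
  field_simp at h0
  linear_combination h0

end Theta

/-! ### Zeros of the Theta function -/

section Theta

variable {p : ℂ}

theorem isOpen_puncturedBall (R : ℝ) : IsOpen {z : ℂ | 0 < ‖z‖ ∧ ‖z‖ < R} :=
  (isOpen_lt continuous_const continuous_norm).inter (isOpen_lt continuous_norm continuous_const)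

/-- A holomorphic function on `ℂ*` with the functional equation of the Theta function is a multiple
of the Theta function. -/
theorem exists_eq_const_mul_theta (hp : 1 < ‖p‖) {f : ℂ → ℂ}
    (hf : ∀ w, w ≠ 0 → DifferentiableAt ℂ f w) (hfe : ∀ w, w ≠ 0 → f (p * w) = w * f w) :
    ∃ a : ℂ, ∀ w, w ≠ 0 → f w = a * theta p w := by
  have hp0 := ne_zero_of_one_lt_norm hp
  have hd (R : ℝ) : DifferentiableOn ℂ f {z | 0 < ‖z‖ ∧ ‖z‖ < R} :=
    fun z hz => (hf z (norm_pos_iff.mp hz.1)).differentiableWithinAt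
  have hindep {r s : ℝ} (hr : 0 < r) (hs : 0 < s) (k : ℤ) :
      laurentCoeff f r k = laurentCoeff f s k := by
    rcases le_total r s with h | h
    · exact laurentCoeff_eq_of_differentiableOn hr h (lt_add_one s) (hd _) k
    · exact (laurentCoeff_eq_of_differentiableOn hs h (lt_add_one r) (hd _) k).symm
  set a : ℤ → ℂ := laurentCoeff f 1 with ha
  -- Compare the coefficients of order `k + 1` in `f(p w) = w f(w)`: all of them are determined by
  -- `a 0`.
  have hrec (k : ℤ) : a (k + 1) = p ^ (-(k + 1)) * a k := by
    have h1 := laurentCoeff_comp_mul f hp0 1 (k + 1)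
    have h2 : laurentCoeff (fun z => f (p * z)) 1 (k + 1) = laurentCoeff f 1 k := by
      refine Real.circleAverage_congr_sphere fun z hz => ?_
      have hz0 : z ≠ 0 := by
        rintro rfl
        simp at hz
      simp only [hfe z hz0, zpow_neg, zpow_add_one₀ hz0]
      field_simp
    rw [h2, hindep (mul_pos (norm_pos_iff.mpr hp0) one_pos) one_pos] at h1
    rw [ha, h1, ← mul_assoc, ← zpow_add₀ hp0, neg_add_cancel, zpow_zero, one_mul]
  have hcoef (k : ℤ) : a k = a 0 * p ^ (-tri k) := by
    induction k using Int.induction_on with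
    | zero => simp [tri_zero]
    | succ k ih =>
      rw [hrec, ih, tri_add_one, neg_add (tri k), zpow_add₀ hp0]
      ring
    | pred k ih =>
      have h := hrec (-k - 1)
      have ht := tri_add_one (-k - 1)
      rw [sub_add_cancel] at h ht
      rw [h, ht, neg_add, zpow_add₀ hp0] at ih
      refine mul_left_cancel₀ (zpow_ne_zero (-(-k : ℤ)) hp0) (ih.trans ?_)
      ring
  refine ⟨a 0, fun w hw => ?_⟩
  have hw' := norm_pos_iff.mpr hw
  have hc : ∀ k, laurentCoeff f ‖w‖ k = a 0 * p ^ (-tri k) := fun k => by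
    rw [← hcoef, ha, hindep hw' one_pos]
  have hcont : ContinuousOn f (Metric.sphere 0 ‖w‖) := fun z hz =>
    (hf z (norm_pos_iff.mp (by rw [mem_sphere_zero_iff_norm.mp hz]; exact hw'))).continuousAt.continuousWithinAt
  have hw0 : ((‖w‖ : ℝ) : ℂ) ≠ 0 := by exact_mod_cast hw'.ne'
  have hs := hasSum_laurentCoeff hw' hcont (by
    simp only [hc, mul_assoc]
    exact (hasSum_theta hp hw0).summable.mul_left (a 0)) rfl
  simp only [hc, mul_assoc] at hs
  exact hs.unique ((hasSum_theta hp hw).mul_left (a 0))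

/-- The Jacobi product, up to a constant. -/
theorem exists_eulerProd_eq_mul_theta (hp : 1 < ‖p‖) :
    ∃ a : ℂ, a ≠ 0 ∧ ∀ w, w ≠ 0 →
      (1 + w⁻¹) * (eulerProd p w * eulerProd p w⁻¹) = a * theta p w := by
  have hp0 := ne_zero_of_one_lt_norm hp
  obtain ⟨a, ha⟩ := exists_eq_const_mul_theta hp
    (f := fun w => (1 + w⁻¹) * (eulerProd p w * eulerProd p w⁻¹)) (fun w hw => by
      have h1 : DifferentiableAt ℂ (fun w : ℂ => w⁻¹) w := differentiableAt_inv hw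
      have h2 := (differentiable_eulerProd hp) w
      have h3 : DifferentiableAt ℂ (fun w : ℂ => eulerProd p w⁻¹) w :=
        ((differentiable_eulerProd hp) w⁻¹).comp w h1
      exact (h1.const_add 1).mul (h2.mul h3)) (fun w hw => by
      have h1 := eulerProd_mul hp w
      have h2 := eulerProd_mul hp (p * w)⁻¹
      have h3 : p * (p * w)⁻¹ = w⁻¹ := by field_simp
      rw [h3] at h2
      simp only [h1, h2]
      field_simp
      ring)
  refine ⟨a, ?_, ha⟩
  rintro rfl
  -- At `w = 1` the product is `2 (eulerProd p 1)²`. It is nonzero, because the zeros of `eulerProd`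
  -- have norm greater than `1`.
  have h1 := ha 1 one_ne_zero
  have hE : eulerProd p 1 ≠ 0 := by
    intro h
    obtain ⟨n, hn⟩ := exists_zpow_of_eulerProd_eq_zero hp h
    have h2 := congrArg norm hn
    rw [norm_neg, norm_pow, norm_one] at h2
    exact (one_lt_pow₀ hp n.succ_ne_zero).ne h2
  simp [hE] at h1

/-- The three factors of the Jacobi product account for the exponents `k = 0`, `k > 0` and `k < 0`.
-/
theorem exists_eq_neg_zpow_of_theta_eq_zero (hp : 1 < ‖p‖) {w : ℂ} (hw : w ≠ 0)
    (h : theta p w = 0) : ∃ k : ℤ, w = -p ^ k := by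
  obtain ⟨a, -, ha⟩ := exists_eulerProd_eq_mul_theta hp
  have h1 := ha w hw
  rw [h, mul_zero, mul_eq_zero, mul_eq_zero] at h1
  rcases h1 with h1 | h1 | h1
  · refine ⟨0, ?_⟩
    field_simp at h1
    rw [zpow_zero]
    linear_combination h1
  · obtain ⟨n, hn⟩ := exists_zpow_of_eulerProd_eq_zero hp h1
    exact ⟨(n + 1 : ℕ), by rw [zpow_natCast, hn]⟩
  · obtain ⟨n, hn⟩ := exists_zpow_of_eulerProd_eq_zero hp h1
    exact ⟨-(n + 1 : ℕ), by rw [zpow_neg, zpow_natCast, ← inv_neg, ← hn, inv_inv]⟩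

theorem theta_neg_one (hp : 1 < ‖p‖) : theta p (-1) = 0 := by
  obtain ⟨a, ha0, ha⟩ := exists_eulerProd_eq_mul_theta hp
  have := ha (-1) (by norm_num)
  norm_num at this
  exact this.resolve_left ha0

/-- At `-1` only the factor `1 + w⁻¹` of the Jacobi product vanishes, and it does so to first order.
-/
theorem deriv_theta_neg_one_ne_zero (hp : 1 < ‖p‖) : deriv (theta p) (-1) ≠ 0 := by
  obtain ⟨a, ha0, ha⟩ := exists_eulerProd_eq_mul_theta hp
  have hE : eulerProd p (-1) ≠ 0 := by
    intro h
    obtain ⟨n, hn⟩ := exists_zpow_of_eulerProd_eq_zero hp h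
    have h2 := congrArg norm hn
    rw [norm_neg, norm_neg, norm_pow, norm_one] at h2
    exact (one_lt_pow₀ hp n.succ_ne_zero).ne h2
  have hne : (-1 : ℂ) ≠ 0 := by norm_num
  have h1 : HasDerivAt (fun w : ℂ => w⁻¹) (-1) (-1) := by
    simpa using hasDerivAt_inv hne
  have h2 := (differentiable_eulerProd hp) (-1)
  have h3 : DifferentiableAt ℂ (fun w : ℂ => eulerProd p w⁻¹) (-1) :=
    ((differentiable_eulerProd hp) _).comp (-1) h1.differentiableAt
  have h4 := (h1.const_add 1).mul (h2.mul h3).hasDerivAt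
  have h5 : (fun w => (1 + w⁻¹) * (eulerProd p w * eulerProd p w⁻¹)) =ᶠ[𝓝 (-1)]
      fun w => a * theta p w := by
    filter_upwards [isOpen_ne.mem_nhds hne] with w hw using ha w hw
  have h6 := (differentiableAt_theta hp hne).hasDerivAt.const_mul a
  have h7 := (h4.congr_of_eventuallyEq h5.symm).unique h6
  intro h0
  rw [h0, mul_zero] at h7
  norm_num at h7
  exact hE h7

/-- Obtained by differentiating `theta_mul`. At a zero of Theta it carries simplicity from one
spiral point to the next. -/
theorem deriv_theta_mul (hp : 1 < ‖p‖) {w : ℂ} (hw : w ≠ 0) :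
    p * deriv (theta p) (p * w) = theta p w + w * deriv (theta p) w := by
  have hp0 := ne_zero_of_one_lt_norm hp
  have h1 : HasDerivAt (fun w => theta p (p * w)) (deriv (theta p) (p * w) * p) w := by
    have := (differentiableAt_theta hp (mul_ne_zero hp0 hw)).hasDerivAt.comp w
      ((hasDerivAt_id w).const_mul p)
    rw [mul_one] at this
    exact this
  have h2 := (hasDerivAt_id w).mul (differentiableAt_theta hp hw).hasDerivAt
  have h3 : (fun w => theta p (p * w)) =ᶠ[𝓝 w] (id * theta p) := by
    filter_upwards [isOpen_ne.mem_nhds hw] with w hw using theta_mul hp hw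
  have := h1.unique (h2.congr_of_eventuallyEq h3)
  simp only [id, one_mul] at this
  rw [mul_comm, this]

theorem theta_neg_zpow (hp : 1 < ‖p‖) (k : ℤ) : theta p (-p ^ k) = 0 := by
  have h := theta_zpow_mul hp (k - 1) (w := -1) (by norm_num)
  rw [theta_neg_one hp, mul_zero, sub_add_cancel, mul_neg_one] at h
  exact h

theorem deriv_theta_neg_zpow_ne_zero (hp : 1 < ‖p‖) (k : ℤ) : deriv (theta p) (-p ^ k) ≠ 0 := by
  have hp0 := ne_zero_of_one_lt_norm hp
  have step (k : ℤ) : p * deriv (theta p) (-p ^ (k + 1)) = -p ^ k * deriv (theta p) (-p ^ k) := by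
    have := deriv_theta_mul hp (w := -p ^ k) (neg_ne_zero.mpr (zpow_ne_zero _ hp0))
    rw [theta_neg_zpow hp, zero_add] at this
    rw [← this, zpow_add_one₀ hp0]
    congr 2
    ring
  induction k using Int.induction_on with
  | zero => simpa using deriv_theta_neg_one_ne_zero hp
  | succ k ih =>
    intro h
    have h1 := step k
    rw [h, mul_zero] at h1
    exact (mul_ne_zero (neg_ne_zero.mpr (zpow_ne_zero _ hp0)) ih) h1.symm
  | pred k ih =>
    intro h
    have h1 := step (-k - 1)
    rw [h, mul_zero, sub_add_cancel] at h1
    exact (mul_ne_zero hp0 ih) h1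

theorem deriv_theta_ne_zero (hp : 1 < ‖p‖) {w : ℂ} (hw : w ≠ 0) (h : theta p w = 0) :
    deriv (theta p) w ≠ 0 := by
  obtain ⟨k, rfl⟩ := exists_eq_neg_zpow_of_theta_eq_zero hp hw h
  exact deriv_theta_neg_zpow_ne_zero hp k

theorem analyticAt_theta (hp : 1 < ‖p‖) {w : ℂ} (hw : w ≠ 0) : AnalyticAt ℂ (theta p) w := by
  rw [Complex.analyticAt_iff_eventually_differentiableAt]
  filter_upwards [isOpen_ne.mem_nhds hw] with z hz using differentiableAt_theta hp hz

/-- All terms are positive, and the term of index `0` is already `1`. Hence a bounded function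
automatically satisfies the growth condition of `ℍ`. -/
theorem one_lt_norm_theta_ofReal {r x : ℝ} (hr : 1 < r) (hx : 0 < x) :
    1 < ‖theta (r : ℂ) (x : ℂ)‖ := by
  have hr0 : 0 < r := one_pos.trans hr
  have hrn : 1 < ‖(r : ℂ)‖ := by rwa [Complex.norm_real, Real.norm_of_nonneg hr0.le]
  have hx0 : (x : ℂ) ≠ 0 := by exact_mod_cast hx.ne'
  have h1 : HasSum (fun l : ℤ => ((r ^ (-tri l) * x ^ l : ℝ) : ℂ)) (theta r x) := by
    simpa using hasSum_theta hrn hx0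
  have hs := summable_tri hr hx
  have h2 : theta (r : ℂ) (x : ℂ) = ((∑' l : ℤ, r ^ (-tri l) * x ^ l : ℝ) : ℂ) :=
    h1.unique (Complex.hasSum_ofReal.mpr hs.hasSum)
  rw [h2, Complex.norm_real, Real.norm_of_nonneg (tsum_nonneg fun l => by positivity)]
  have h3 := hs.sum_le_tsum {0, 1} (fun l _ => by positivity)
  rw [Finset.sum_pair (by norm_num)] at h3
  simp only [tri_zero, neg_zero, zpow_zero, one_mul, zpow_one] at h3
  have : 0 < r ^ (-tri 1) * x := by positivity
  linarith

end Theta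

/-! ### Domains of continuation -/

/-- The set is the image of a half plane under `exp`. -/
theorem isPreconnected_norm_gt {R : ℝ} (hR : 0 < R) : IsPreconnected {z : ℂ | R < ‖z‖} := by
  have h : {z : ℂ | R < ‖z‖} = Complex.exp '' {w : ℂ | Real.log R < w.re} := by
    ext z
    constructor
    · intro hz
      have hz0 : z ≠ 0 := norm_pos_iff.mp (hR.trans hz)
      refine ⟨Complex.log z, ?_, Complex.exp_log hz0⟩
      rw [Set.mem_ofPred_eq, Complex.log_re]
      exact Real.log_lt_log hR hz
    · rintro ⟨w, hw, rfl⟩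
      rw [Set.mem_ofPred_eq, Complex.norm_exp]
      exact (Real.log_lt_iff_lt_exp hR).mp hw
  rw [h]
  exact (convex_halfSpace_re_gt _).isPreconnected.image _ Complex.continuous_exp.continuousOn

/-- Finitely many points of a path connected set can be added to a compact connected subset. -/
theorem exists_isCompact_isPreconnected_superset {X : Type*} [TopologicalSpace X] {S K₀ F : Set X}
    {x : X} (hS : IsPathConnected S) (hK₀ : IsCompact K₀) (hK₀' : IsPreconnected K₀) (hx : x ∈ K₀)
    (hK₀S : K₀ ⊆ S) (hF : F.Finite) (hFS : F ⊆ S) :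
    ∃ K, IsCompact K ∧ IsPreconnected K ∧ K₀ ⊆ K ∧ F ⊆ K ∧ K ⊆ S := by
  induction F, hF using Set.Finite.induction_on with
  | empty => exact ⟨K₀, hK₀, hK₀', subset_rfl, Set.empty_subset _, hK₀S⟩
  | @insert a F _ _ ih =>
    obtain ⟨K, hK, hK', h0, hFK, hKS⟩ := ih ((Set.subset_insert _ _).trans hFS)
    obtain ⟨γ, hγ⟩ := hS.joinedIn x (hK₀S hx) a (hFS (Set.mem_insert _ _))
    refine ⟨K ∪ Set.range γ, hK.union (isCompact_range γ.continuous), ?_,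
      h0.trans Set.subset_union_left, ?_, Set.union_subset hKS (Set.range_subset_iff.mpr hγ)⟩
    · exact IsPreconnected.union x (h0 hx) ⟨0, γ.source⟩ hK' (isPreconnected_range γ.continuous)
    · exact Set.insert_subset (Or.inr ⟨1, γ.target⟩) (hFK.trans Set.subset_union_left)

/-- The thickening is a union of connected sets `K ∪ ball z δ` with `z ∈ K`, all containing `x`. -/
theorem isPreconnected_thickening {X : Type*} [PseudoMetricSpace X] {K : Set X} {x : X}
    (hK : IsPreconnected K) (hx : x ∈ K) {δ : ℝ} (hδ : 0 < δ)
    (hball : ∀ y : X, IsPreconnected (Metric.ball y δ)) : IsPreconnected (Metric.thickening δ K) := by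
  refine isPreconnected_of_forall x fun y hy => ?_
  obtain ⟨z, hz, hyz⟩ := Metric.mem_thickening_iff.mp hy
  refine ⟨K ∪ Metric.ball z δ, Set.union_subset (Metric.self_subset_thickening hδ K) ?_,
    Or.inl hx, Or.inr hyz, IsPreconnected.union z hz (Metric.mem_ball_self hδ) hK (hball z)⟩
  exact Metric.ball_subset_thickening hz δ

theorem finite_setOf_zpow_mem_Icc {x a b : ℝ} (hx : 1 < x) (ha : 0 < a) :
    {l : ℤ | a ≤ x ^ l ∧ x ^ l ≤ b}.Finite := by
  obtain ⟨m, hm⟩ := pow_unbounded_of_one_lt b hx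
  obtain ⟨n, hn⟩ := pow_unbounded_of_one_lt a⁻¹ hx
  refine (Set.finite_Icc (-(n : ℤ)) m).subset fun l hl => ⟨?_, ?_⟩
  · by_contra! h
    have h1 : x ^ l < x ^ (-(n : ℤ)) := zpow_lt_zpow_right₀ hx h
    rw [zpow_neg, zpow_natCast] at h1
    have := inv_lt_of_inv_lt₀ ha hn
    linarith [hl.1]
  · by_contra! h
    have h1 : x ^ (m : ℤ) < x ^ l := zpow_lt_zpow_right₀ hx h
    rw [zpow_natCast] at h1
    linarith [hl.2]

/-- A connected open set containing `0`, a neighbourhood of infinity, and discs of a fixed relative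
radius around the points of a discrete spiral, that stays away from a given finite set. -/
theorem exists_isConnected_spiral_domain {Z : Set ℂ} (hZ : Z.Finite) (hZ0 : (0 : ℂ) ∉ Z)
    {p lam : ℂ} (hp : 1 < ‖p‖) (hlam : lam ≠ 0) (hs : ∀ l : ℤ, p ^ l * lam ∉ Z) :
    ∃ (ε : ℝ) (Ω : Set ℂ) (δ : ℝ), 0 < ε ∧ IsOpen Ω ∧ IsConnected Ω ∧ 0 < δ ∧
      (∀ (l : ℤ) (z : ℂ), ‖z - p ^ l * lam‖ < ε * ‖p ^ l * lam‖ → z ∈ Ω) ∧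
      ∀ z ∈ Ω, ∀ β ∈ Z, δ ≤ ‖z - β‖ := by
  obtain ⟨r, hr, hrZ⟩ : ∃ r : ℝ, 0 < r ∧ Metric.closedBall 0 r ⊆ Zᶜ :=
    Metric.nhds_basis_closedBall.mem_iff.mp (hZ.isClosed.isOpen_compl.mem_nhds hZ0)
  obtain ⟨R₀, hR₀⟩ := hZ.isBounded.exists_norm_le
  set R := max R₀ 0 + 1 with hRdef
  have hR : 1 ≤ R := by simp [hRdef]
  have hRZ : ∀ β ∈ Z, ‖β‖ + 1 ≤ R := fun β hβ => by
    have := (hR₀ β hβ).trans (le_max_left R₀ 0)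
    linarith
  have hlam' : 0 < ‖lam‖ := norm_pos_iff.mpr hlam
  -- Only finitely many spiral points lie outside both the small disc and the exterior region. The
  -- extra point `R + 1` links the compact part to the exterior region.
  set F : Set ℂ := insert ((R + 1 : ℝ) : ℂ)
    ((fun l : ℤ => p ^ l * lam) '' {l | r / 2 / ‖lam‖ ≤ ‖p‖ ^ l ∧ ‖p‖ ^ l ≤ 2 * R / ‖lam‖})
  have hF : F.Finite := ((finite_setOf_zpow_mem_Icc hp (by positivity)).image _).insert _
  have hnR : ‖((R + 1 : ℝ) : ℂ)‖ = R + 1 := by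
    rw [Complex.norm_real, Real.norm_of_nonneg (by linarith)]
  have hFZ : F ⊆ Zᶜ := by
    refine Set.insert_subset (fun h => ?_) ?_
    · have := hRZ _ h
      rw [hnR] at this
      linarith
    · rintro _ ⟨l, -, rfl⟩
      exact hs l
  have hS : IsPathConnected Zᶜ :=
    hZ.countable.isPathConnected_compl_of_one_lt_rank (by simp)
  have h0 : (0 : ℂ) ∈ Metric.closedBall 0 r := Metric.mem_closedBall_self hr.le
  obtain ⟨K, hK, hK', hrK, hFK, hKZ⟩ := exists_isCompact_isPreconnected_superset hS
    (isCompact_closedBall 0 r) (convex_closedBall 0 r).isPreconnected h0 hrZ hF hFZ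
  obtain ⟨δ, hδ, hdisj⟩ := (Set.disjoint_left.mpr fun z hz hz' => hKZ hz hz' :
    Disjoint K Z).exists_thickenings hK hZ.isClosed
  have hKδ := Metric.self_subset_thickening hδ K
  -- The bound `1/2` keeps discs about points of norm below `r/2` inside the disc of radius `r`, and
  -- those about points of norm above `2R` outside radius `R`. The bound `δ/(2R)` keeps the
  -- remaining discs within `δ` of `K`.
  refine ⟨min (1 / 2) (δ / (2 * R)), Metric.thickening δ K ∪ {z | R < ‖z‖}, min δ 1,
    by positivity, Metric.isOpen_thickening.union (isOpen_lt continuous_const continuous_norm),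
    ⟨⟨0, Or.inl (hKδ (hrK h0))⟩, ?_⟩, by positivity, ?_, ?_⟩
  · refine IsPreconnected.union ((R + 1 : ℝ) : ℂ) (hKδ (hFK (Set.mem_insert _ _))) ?_
      (isPreconnected_thickening hK' (hrK h0) hδ fun y => (convex_ball y δ).isPreconnected)
      (isPreconnected_norm_gt (by linarith))
    rw [Set.mem_ofPred_eq, hnR]
    linarith
  · intro l z hz
    have hsn : ‖p ^ l * lam‖ = ‖p‖ ^ l * ‖lam‖ := by rw [norm_mul, norm_zpow]
    set s := p ^ l * lam with hsdef
    have hz1 : ‖z - s‖ < 1 / 2 * ‖s‖ :=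
      hz.trans_le (mul_le_mul_of_nonneg_right (min_le_left _ _) (norm_nonneg _))
    have hz2 : ‖z - s‖ < δ / (2 * R) * ‖s‖ :=
      hz.trans_le (mul_le_mul_of_nonneg_right (min_le_right _ _) (norm_nonneg _))
    have htri1 : ‖z‖ ≤ ‖z - s‖ + ‖s‖ := norm_le_norm_sub_add z s
    have htri2 : ‖s‖ ≤ ‖z‖ + ‖z - s‖ := by
      have := norm_sub_norm_le s z
      rw [norm_sub_rev] at this
      linarith
    rcases lt_or_ge ‖s‖ (r / 2) with h1 | h1
    · exact Or.inl (hKδ (hrK (mem_closedBall_zero_iff.mpr (by linarith))))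
    rcases lt_or_ge (2 * R) ‖s‖ with h2 | h2
    · right
      rw [Set.mem_ofPred_eq]
      linarith
    · left
      have hsF : s ∈ F := by
        refine Or.inr ⟨l, ⟨?_, ?_⟩, rfl⟩
        · rwa [div_le_iff₀ hlam', ← hsn]
        · rwa [le_div_iff₀ hlam', ← hsn]
      refine Metric.mem_thickening_iff.mpr ⟨s, hFK hsF, ?_⟩
      rw [dist_eq_norm]
      refine hz2.trans_le ?_
      rw [div_mul_eq_mul_div, div_le_iff₀ (by positivity)]
      gcongr
  · intro z hz β hβ
    rcases hz with hz | hz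
    · refine (min_le_left _ _).trans ?_
      by_contra! h
      have hz' : z ∈ Metric.thickening δ Z :=
        Metric.mem_thickening_iff.mpr ⟨β, hβ, by rwa [dist_eq_norm]⟩
      exact Set.disjoint_left.mp hdisj hz hz'
    · refine (min_le_right _ _).trans ?_
      have h1 := hRZ β hβ
      have h2 := norm_sub_norm_le z β
      rw [Set.mem_ofPred_eq] at hz
      linarith

/-! ### Powers of `q` and the spiral -/

section Powers

variable {q τ : ℂ} {N : ℕ}

theorem qpow_add (τ α β : ℂ) : qpow τ (α + β) = qpow τ α * qpow τ β := by
  rw [qpow, qpow, qpow, ← Complex.exp_add, add_mul]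

theorem qpow_ne_zero (τ α : ℂ) : qpow τ α ≠ 0 := Complex.exp_ne_zero _

theorem qpow_intCast_mul (τ α : ℂ) (l : ℤ) : qpow τ (l * α) = qpow τ α ^ l := by
  rw [qpow, qpow, ← Complex.exp_int_mul, mul_assoc]

theorem qpow_intCast_div (τ : ℂ) (N : ℕ) (l : ℤ) : qpow τ (l / N) = qpow τ (1 / N) ^ l := by
  rw [← qpow_intCast_mul, mul_one_div]

theorem qpow_one_div_pow (hτ : Complex.exp τ = q) (hN : N ≠ 0) : qpow τ (1 / N) ^ N = q := by
  have hN' : (N : ℂ) ≠ 0 := Nat.cast_ne_zero.mpr hN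
  rw [← zpow_natCast, ← qpow_intCast_mul, Int.cast_natCast, mul_one_div_cancel hN', qpow, one_mul,
    hτ]

theorem one_lt_norm_qpow (hq : 1 < ‖q‖) (hτ : Complex.exp τ = q) (hN : N ≠ 0) :
    1 < ‖qpow τ (1 / N)‖ := by
  by_contra! h
  have := pow_le_one₀ (n := N) (norm_nonneg _) h
  rw [← norm_pow, qpow_one_div_pow hτ hN] at this
  linarith

theorem spiralPoint_eq (τ : ℂ) (N : ℕ) (lam : ℂ) (l : ℤ) :
    spiralPoint τ N lam l = qpow τ (1 / N) ^ l * lam := by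
  rw [spiralPoint, qpow_intCast_div]

end Powers

/-! ### Identity theorem for meromorphic functions on `ℂ*` -/

theorem isPreconnected_compl_zero : IsPreconnected ({0}ᶜ : Set ℂ) :=
  (isConnected_compl_singleton_of_one_lt_rank (by simp) 0).isPreconnected

/-- On the connected set `ℂ*`, infinite order of `f - g` at one point propagates to every point. -/
theorem eventuallyEq_of_meromorphicOn {f g : ℂ → ℂ} (hf : MeromorphicOn f {0}ᶜ)
    (hg : MeromorphicOn g {0}ᶜ) {w₀ : ℂ} (hw₀ : w₀ ≠ 0) (h : ∀ᶠ z in 𝓝[≠] w₀, f z = g z) {w : ℂ}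
    (hw : w ≠ 0) : ∀ᶠ z in 𝓝[≠] w, f z = g z := by
  have hd : MeromorphicOn (f - g) {0}ᶜ := hf.sub hg
  have h0 : meromorphicOrderAt (f - g) w₀ = ⊤ := by
    rw [meromorphicOrderAt_eq_top_iff]
    filter_upwards [h] with z hz
    rw [Pi.sub_apply, hz, sub_self]
  have h1 : meromorphicOrderAt (f - g) w = ⊤ := by
    by_contra h2
    exact hd.meromorphicOrderAt_ne_top_of_isPreconnected isPreconnected_compl_zero hw hw₀ h2 h0
  rw [meromorphicOrderAt_eq_top_iff] at h1
  filter_upwards [h1] with z hz using sub_eq_zero.mp hz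

/-! ### The Laplace transform of a quotient of entire functions -/

/-- `num` and `den` are entire functions, `den` has finitely many zeros, which avoid `0` and the
spiral `lam p ^ ℤ`, and `num / den` is bounded at infinity. -/
structure IsSpiralQuotient (p lam : ℂ) (num den : ℂ → ℂ) : Prop where
  differentiable_num : Differentiable ℂ num
  differentiable_den : Differentiable ℂ den
  finite_zeros : {ζ | den ζ = 0}.Finite
  den_zero : den 0 ≠ 0
  den_spiral : ∀ l : ℤ, den (p ^ l * lam) ≠ 0
  bounded : ∃ R M : ℝ, ∀ ζ, R < ‖ζ‖ → ‖num ζ / den ζ‖ ≤ M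

/-- The `q`-Laplace transform along the spiral `lam p ^ ℤ`, as a quotient of Theta series. -/
noncomputable def laplaceQuotient (p lam : ℂ) (f : ℂ → ℂ) (z : ℂ) : ℂ :=
  thetaSeries (fun l => f (p ^ l * lam)) p (z / lam) / theta p (z / lam)

/-- Gives all Laplace terms the common denominator `Θ_p(z / lam)`, so that the transform becomes a
quotient of two Theta-type series. -/
theorem div_theta_zpow {p lam z : ℂ} (hp : 1 < ‖p‖) (hlam : lam ≠ 0) (hz : z ≠ 0) (b : ℂ) (l : ℤ) :
    b / theta p (p ^ (l + 1) * lam / z) =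
      b * (p ^ (-tri l) * (z / lam) ^ l) / theta p (z / lam) := by
  have hw : z / lam ≠ 0 := div_ne_zero hz hlam
  have h1 : p ^ (l + 1) * lam / z = p ^ (l + 1) * (z / lam)⁻¹ := by
    rw [inv_div, mul_div_assoc]
  rw [h1, theta_zpow_mul hp l (inv_ne_zero hw), theta_inv hp hw]
  set w := z / lam
  have h2 : p ^ tri l * w⁻¹ ^ (l + 1) * (w * theta p w) = (p ^ (-tri l) * w ^ l)⁻¹ * theta p w := by
    rw [inv_zpow, zpow_add_one₀ hw, zpow_neg, mul_inv, mul_inv, inv_inv]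
    field_simp
  rw [h2, div_mul_eq_div_div, div_inv_eq_mul]

theorem analyticAt_div_const (w lam : ℂ) : AnalyticAt ℂ (fun z => z / lam) w :=
  Complex.analyticAt_iff_eventually_differentiableAt.mpr
    (Eventually.of_forall fun _ => differentiableAt_id.div_const lam)

theorem analyticAt_theta_div {p lam w : ℂ} (hp : 1 < ‖p‖) (hlam : lam ≠ 0) (hw : w ≠ 0) :
    AnalyticAt ℂ (fun z => theta p (z / lam)) w :=
  (analyticAt_theta hp (div_ne_zero hw hlam)).comp_of_eq (analyticAt_div_const w lam) rfl

theorem deriv_theta_div_ne_zero {p lam w : ℂ} (hp : 1 < ‖p‖) (hlam : lam ≠ 0) (hw : w ≠ 0)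
    (h : theta p (w / lam) = 0) : deriv (fun z => theta p (z / lam)) w ≠ 0 := by
  have hw' : w / lam ≠ 0 := div_ne_zero hw hlam
  have h1 := (differentiableAt_theta hp hw').hasDerivAt.comp w ((hasDerivAt_id w).div_const lam)
  have h2 : HasDerivAt (fun z => theta p (z / lam)) (deriv (theta p) (w / lam) * (1 / lam)) w := h1
  rw [h2.deriv]
  exact mul_ne_zero (deriv_theta_ne_zero hp hw' h) (one_div_ne_zero hlam)

/-- The zeros are simple, hence isolated. -/
theorem eventually_theta_div_ne_zero {p lam w : ℂ} (hp : 1 < ‖p‖) (hlam : lam ≠ 0) (hw : w ≠ 0) :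
    ∀ᶠ z in 𝓝[≠] w, theta p (z / lam) ≠ 0 := by
  by_cases h : theta p (w / lam) = 0
  · exact (analyticAt_theta_div hp hlam hw).differentiableAt.hasDerivAt.eventually_ne (c := 0)
      (deriv_theta_div_ne_zero hp hlam hw h)
  · exact ((analyticAt_theta_div hp hlam hw).continuousAt.eventually_ne h).filter_mono
      nhdsWithin_le_nhds

/-! ### Continuation, existence and uniqueness of the Borel–Laplace sum of a quotient -/

namespace IsSpiralQuotient

variable {p lam : ℂ} {num den : ℂ → ℂ}

/-- Far out, the bound is an assumption. The rest of `Ω` lies in a compact set of points at distance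
at least `δ` from the zeros of `den`, where the quotient is continuous. -/
theorem exists_domain (h : IsSpiralQuotient p lam num den) (hp : 1 < ‖p‖) (hlam : lam ≠ 0) :
    ∃ (ε : ℝ) (Ω : Set ℂ) (M : ℝ), 0 < ε ∧ IsOpen Ω ∧ IsConnected Ω ∧
      (∀ (l : ℤ) (z : ℂ), ‖z - p ^ l * lam‖ < ε * ‖p ^ l * lam‖ → z ∈ Ω) ∧
      (∀ z ∈ Ω, den z ≠ 0) ∧ ∀ z ∈ Ω, ‖num z / den z‖ ≤ M := by
  obtain ⟨ε, Ω, δ, hε, hΩ, hΩ', hδ, hsp, hfar⟩ := exists_isConnected_spiral_domain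
    h.finite_zeros h.den_zero hp hlam h.den_spiral
  obtain ⟨R, M₁, hM₁⟩ := h.bounded
  have hden {z : ℂ} (hz : ∀ β ∈ {ζ | den ζ = 0}, δ ≤ ‖z - β‖) : den z ≠ 0 := fun h0 => by
    have := hz z h0
    rw [sub_self, norm_zero] at this
    linarith
  have hC : IsCompact (Metric.closedBall (0 : ℂ) R ∩
      ⋂ β ∈ {ζ | den ζ = 0}, {z | δ ≤ ‖z - β‖}) := by
    refine (isCompact_closedBall 0 R).inter_right (isClosed_biInter fun β _ => ?_)
    exact isClosed_le continuous_const (by fun_prop)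
  obtain ⟨M₂, hM₂⟩ := hC.exists_bound_of_continuousOn (f := fun z => num z / den z)
    (h.differentiable_num.continuous.continuousOn.div h.differentiable_den.continuous.continuousOn
      fun z hz => hden (by simpa using hz.2))
  refine ⟨ε, Ω, max M₁ M₂, hε, hΩ, hΩ', hsp, fun z hz => hden (hfar z hz), fun z hz => ?_⟩
  rcases lt_or_ge R ‖z‖ with hR | hR
  · exact (hM₁ z hR).trans (le_max_left _ _)
  · refine (hM₂ z ⟨mem_closedBall_zero_iff.mpr hR, ?_⟩).trans (le_max_right _ _)
    simpa using hfar z hz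

theorem exists_bound_spiral (h : IsSpiralQuotient p lam num den) (hp : 1 < ‖p‖) (hlam : lam ≠ 0) :
    ∃ M : ℝ, ∀ l : ℤ, ‖num (p ^ l * lam) / den (p ^ l * lam)‖ ≤ M := by
  obtain ⟨ε, Ω, M, hε, -, -, hsp, -, hM⟩ := h.exists_domain hp hlam
  refine ⟨M, fun l => hM _ (hsp l _ ?_)⟩
  rw [sub_self, norm_zero]
  have : 0 < ‖p ^ l * lam‖ :=
    norm_pos_iff.mpr (mul_ne_zero (zpow_ne_zero _ (ne_zero_of_one_lt_norm hp)) hlam)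
  positivity

theorem analyticAt_thetaSeries (h : IsSpiralQuotient p lam num den) (hp : 1 < ‖p‖)
    (hlam : lam ≠ 0) {w : ℂ} (hw : w ≠ 0) :
    AnalyticAt ℂ (thetaSeries (fun l => num (p ^ l * lam) / den (p ^ l * lam)) p) w := by
  obtain ⟨M, hM⟩ := h.exists_bound_spiral hp hlam
  rw [Complex.analyticAt_iff_eventually_differentiableAt]
  filter_upwards [isOpen_ne.mem_nhds hw] with z hz using differentiableAt_thetaSeries hM hp hz

theorem meromorphicOn_laplaceQuotient (h : IsSpiralQuotient p lam num den) (hp : 1 < ‖p‖)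
    (hlam : lam ≠ 0) : MeromorphicOn (laplaceQuotient p lam fun ζ => num ζ / den ζ) {0}ᶜ := by
  intro w hw
  have hw' : w / lam ≠ 0 := div_ne_zero hw hlam
  exact ((h.analyticAt_thetaSeries hp hlam hw').comp_of_eq (analyticAt_div_const w lam)
    rfl).meromorphicAt.div (analyticAt_theta_div hp hlam hw).meromorphicAt

theorem meromorphic (h : IsSpiralQuotient p lam num den) (w : ℂ) :
    MeromorphicAt (fun ζ => num ζ / den ζ) w :=
  (h.differentiable_num.analyticAt w).meromorphicAt.div
    (h.differentiable_den.analyticAt w).meromorphicAt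

theorem meromorphicNearZero (h : IsSpiralQuotient p lam num den) :
    MeromorphicNearZero fun ζ => num ζ / den ζ :=
  ⟨1, one_pos, fun w _ => h.meromorphic w⟩

variable {q τ : ℂ} {N : ℕ}

/-- The quotient is its own continuation; boundedness on `Ω` suffices since Theta exceeds `1` at
positive reals. -/
theorem isGrowthContinuation (hq : 1 < ‖q‖) (hτ : Complex.exp τ = q) (hN : N ≠ 0)
    (h : IsSpiralQuotient (qpow τ (1 / N)) lam num den) (hlam : lam ≠ 0) :
    IsGrowthContinuation q τ N N lam (fun ζ => num ζ / den ζ) (fun ζ => num ζ / den ζ) := by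
  have hp := one_lt_norm_qpow hq hτ hN
  obtain ⟨ε, Ω, M, hε, hΩ, hΩ', hsp, hden, hM⟩ := h.exists_domain hp hlam
  refine ⟨ε, Ω, hε, hΩ, hΩ', fun l z _ hz => hsp l z (by rwa [spiralPoint_eq] at hz), ?_,
    ⟨1, one_pos, fun w _ _ _ => Eventually.of_forall fun z => rfl⟩, max M 1, 1, by positivity,
    one_pos, fun z hz hz0 => ?_⟩
  · exact fun z hz => ((h.differentiable_num z).div (h.differentiable_den z)
      (hden z hz)).differentiableWithinAt
  · have h1 : 1 < ‖q‖ ^ (1 / (((N : ℕ) : ℚ) : ℝ)) := by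
      have : 0 < N := Nat.pos_of_ne_zero hN
      exact Real.one_lt_rpow hq (by positivity)
    have h2 := one_lt_norm_theta_ofReal h1 (x := 1 * ‖z‖) (by simpa using hz0)
    have h3 : 0 < max M 1 := by positivity
    calc ‖num z / den z‖ ≤ max M 1 := (hM z hz).trans (le_max_left _ _)
      _ < _ := lt_mul_of_one_lt_right h3 h2

theorem seriesMemH (hq : 1 < ‖q‖) (hτ : Complex.exp τ = q) (hN : N ≠ 0)
    (h : IsSpiralQuotient (qpow τ (1 / N)) lam num den) (hlam : lam ≠ 0) {F : PowerSeries ℂ}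
    (hF : IsSumNearZero F fun ζ => num ζ / den ζ) : SeriesMemH q τ N N lam F :=
  ⟨_, hF, h.meromorphicNearZero, _, h.isGrowthContinuation hq hτ hN hlam⟩

theorem laplace_term_eq (hq : 1 < ‖q‖) (hτ : Complex.exp τ = q) (hN : N ≠ 0) (hlam : lam ≠ 0)
    {z : ℂ} (hz : z ≠ 0) (b : ℂ) (l : ℤ) :
    (((N : ℚ) : ℂ) / (N : ℂ)) * (b / theta (qpow τ (1 / ((N : ℚ) : ℂ)))
        (qpow τ (1 / ((N : ℚ) : ℂ) + (l : ℂ) / (N : ℂ)) * lam / z)) =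
      b * (qpow τ (1 / N) ^ (-tri l) * (z / lam) ^ l) / theta (qpow τ (1 / N)) (z / lam) := by
  have hN' : (N : ℂ) ≠ 0 := Nat.cast_ne_zero.mpr hN
  have hp := one_lt_norm_qpow hq hτ hN
  have h1 : qpow τ (1 / (N : ℂ) + (l : ℂ) / (N : ℂ)) = qpow τ (1 / N) ^ (l + 1) := by
    rw [qpow_add, qpow_intCast_div, zpow_add_one₀ (qpow_ne_zero _ _), mul_comm]
  rw [Rat.cast_natCast, div_self hN', one_mul, h1, div_theta_zpow hp hlam hz]

theorem isBorelLaplaceSum (hq : 1 < ‖q‖) (hτ : Complex.exp τ = q) (hN : N ≠ 0)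
    (h : IsSpiralQuotient (qpow τ (1 / N)) lam num den) (hlam : lam ≠ 0) {F : PowerSeries ℂ}
    (hF : IsSumNearZero (qBorel τ N F) fun ζ => num ζ / den ζ) :
    IsBorelLaplaceSum q τ N N lam F
      (laplaceQuotient (qpow τ (1 / N)) lam fun ζ => num ζ / den ζ) := by
  have hp := one_lt_norm_qpow hq hτ hN
  obtain ⟨M, hM⟩ := h.exists_bound_spiral hp hlam
  refine ⟨h.meromorphicOn_laplaceQuotient hp hlam, _, hF, h.meromorphicNearZero, _,
    h.isGrowthContinuation hq hτ hN hlam, 1, one_pos, fun z hz _ _ => ?_⟩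
  have hz0 : z ≠ 0 := norm_pos_iff.mp hz
  refine ((hasSum_thetaSeries hM hp (div_ne_zero hz0 hlam)).div_const
    (theta (qpow τ (1 / N)) (z / lam))).congr_fun fun l => ?_
  rw [laplace_term_eq hq hτ hN hlam hz0, spiralPoint_eq]

theorem exists_zpow_norm_lt (hp : 1 < ‖p‖) (lam : ℂ) {r : ℝ} (hr : 0 < r) :
    ∃ l : ℤ, ‖p ^ l * lam‖ < r := by
  obtain ⟨n, hn⟩ := pow_unbounded_of_one_lt (‖lam‖ / r) hp
  refine ⟨-n, ?_⟩
  have : 0 < ‖p‖ ^ n := by positivity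
  rw [norm_mul, norm_zpow, zpow_neg, zpow_natCast, inv_mul_lt_iff₀ this]
  rwa [div_lt_iff₀ hr] at hn

/-- The values entering the Laplace sum do not depend on the continuation. The spiral accumulates at
`0`, so some spiral point lies where `g` agrees with `f`, and the identity theorem on `Ω` does the
rest. -/
theorem eq_of_isGrowthContinuation (hq : 1 < ‖q‖) (hτ : Complex.exp τ = q) (hN : N ≠ 0)
    (h : IsSpiralQuotient (qpow τ (1 / N)) lam num den) (hlam : lam ≠ 0) {f g : ℂ → ℂ} {r : ℝ}
    (hr : 0 < r) (hf : ∀ z, ‖z‖ < r → f z = num z / den z)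
    (hg : IsGrowthContinuation q τ N N lam f g) (l : ℤ) :
    g (qpow τ (1 / N) ^ l * lam) = num (qpow τ (1 / N) ^ l * lam) / den (qpow τ (1 / N) ^ l * lam)
    := by
  have hp := one_lt_norm_qpow hq hτ hN
  obtain ⟨ε, Ω, hε, hΩ, hΩ', hsp, hgd, ⟨r', hr', hgf⟩, -⟩ := hg
  have hsp0 (l : ℤ) : qpow τ (1 / N) ^ l * lam ≠ 0 :=
    mul_ne_zero (zpow_ne_zero _ (qpow_ne_zero _ _)) hlam
  have hmem (l : ℤ) : qpow τ (1 / N) ^ l * lam ∈ Ω := by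
    refine hsp l _ (hsp0 l) ?_
    rw [spiralPoint_eq, sub_self, norm_zero]
    have := norm_pos_iff.mpr (hsp0 l)
    positivity
  obtain ⟨k, hk⟩ := exists_zpow_norm_lt hp lam (lt_min hr hr')
  -- The comparison is between `g * den` and `num`, because the domain `Ω` of an arbitrary
  -- continuation may contain zeros of `den`.
  have hev : ∀ᶠ z in 𝓝[≠] (qpow τ (1 / N) ^ k * lam), g z * den z = num z := by
    have h1 := hgf _ (hmem k) (norm_pos_iff.mpr (hsp0 k)) (hk.trans_le (min_le_right _ _))
    have h2 : ∀ᶠ z in 𝓝 (qpow τ (1 / N) ^ k * lam), ‖z‖ < r :=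
      continuous_norm.continuousAt.eventually_lt continuousAt_const (hk.trans_le (min_le_left _ _))
    have h3 : ∀ᶠ z in 𝓝 (qpow τ (1 / N) ^ k * lam), den z ≠ 0 :=
      h.differentiable_den.continuous.continuousAt.eventually_ne (h.den_spiral k)
    filter_upwards [h1, h2.filter_mono nhdsWithin_le_nhds, h3.filter_mono nhdsWithin_le_nhds]
      with z hz1 hz2 hz3
    rw [hz1, hf z hz2, div_mul_cancel₀ _ hz3]
  have hEq := AnalyticOnNhd.eqOn_of_preconnected_of_frequently_eq (f := fun z => g z * den z)
    (g := num) ((hgd.mul h.differentiable_den.differentiableOn).analyticOnNhd hΩ)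
    (h.differentiable_num.differentiableOn.analyticOnNhd hΩ) hΩ'.isPreconnected (hmem k)
    hev.frequently
  rw [eq_div_iff (h.den_spiral l)]
  exact hEq (hmem l)

/-- The series fixes `f` near `0`, hence `g` on the spiral, hence `s` near `0` off the poles, and
finally `s` on `ℂ*` by the identity theorem. -/
theorem eventuallyEq_of_isBorelLaplaceSum (hq : 1 < ‖q‖) (hτ : Complex.exp τ = q) (hN : N ≠ 0)
    (h : IsSpiralQuotient (qpow τ (1 / N)) lam num den) (hlam : lam ≠ 0) {F : PowerSeries ℂ}
    (hF : IsSumNearZero (qBorel τ N F) fun ζ => num ζ / den ζ) {s : ℂ → ℂ}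
    (hs : IsBorelLaplaceSum q τ N N lam F s) {w : ℂ} (hw : w ≠ 0) :
    ∀ᶠ z in 𝓝[≠] w, s z = laplaceQuotient (qpow τ (1 / N)) lam (fun ζ => num ζ / den ζ) z := by
  have hp := one_lt_norm_qpow hq hτ hN
  obtain ⟨M, hM⟩ := h.exists_bound_spiral hp hlam
  obtain ⟨hsm, f, ⟨r₁, hr₁, hf⟩, -, g, hg, r₂, hr₂, hsum⟩ := hs
  obtain ⟨r₀, hr₀, hF⟩ := hF
  have hg' := h.eq_of_isGrowthContinuation hq hτ hN hlam (lt_min hr₀ hr₁)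
    (fun z hz => (hf z (hz.trans_le (min_le_right _ _))).unique
      (hF z (hz.trans_le (min_le_left _ _)))) hg
  have hw₀ : ((r₂ / 2 : ℝ) : ℂ) ≠ 0 := by exact_mod_cast (half_pos hr₂).ne'
  refine eventuallyEq_of_meromorphicOn hsm (h.meromorphicOn_laplaceQuotient hp hlam) hw₀ ?_ hw
  have hn : ‖((r₂ / 2 : ℝ) : ℂ)‖ < r₂ := by
    rw [Complex.norm_real, Real.norm_of_nonneg (by positivity)]
    linarith
  have h1 : ∀ᶠ z in 𝓝 ((r₂ / 2 : ℝ) : ℂ), ‖z‖ < r₂ :=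
    continuous_norm.continuousAt.eventually_lt continuousAt_const hn
  have h2 := eventually_theta_div_ne_zero hp hlam hw₀
  have h3 : ∀ᶠ z in 𝓝 ((r₂ / 2 : ℝ) : ℂ), z ≠ 0 := isOpen_ne.mem_nhds hw₀
  filter_upwards [h1.filter_mono nhdsWithin_le_nhds, h2, h3.filter_mono nhdsWithin_le_nhds]
    with z hz1 hz2 hz3
  have hz4 := hsum z (norm_pos_iff.mpr hz3) hz1 fun l hl => hz2 (by
    rw [hl, spiralPoint_eq, neg_div, mul_div_assoc, div_self hlam, mul_one, theta_neg_zpow hp])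
  refine hz4.unique (((hasSum_thetaSeries hM hp (div_ne_zero hz3 hlam)).div_const
    (theta (qpow τ (1 / N)) (z / lam))).congr_fun fun l => ?_)
  rw [laplace_term_eq hq hτ hN hlam hz3, spiralPoint_eq, hg']

end IsSpiralQuotient

/-! ### Sequences with `b (l + N) = A b l` and their generating functions -/

section Resolvent

variable {ι : Type} [Fintype ι] {N : ℕ} {A : Matrix ι ι ℂ} {b : ℕ → ι → ℂ}

theorem exists_norm_mulVec_le (A : Matrix ι ι ℂ) :
    ∃ L : ℝ, 0 ≤ L ∧ ∀ v : ι → ℂ, ‖A *ᵥ v‖ ≤ L * ‖v‖ :=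
  ⟨_, norm_nonneg _, (LinearMap.toContinuousLinearMap (Matrix.mulVecLin A)).le_opNorm⟩

theorem exists_geometric_bound (hN : N ≠ 0) (hb : ∀ l, b (l + N) = A *ᵥ b l) :
    ∃ C ρ : ℝ, 0 < ρ ∧ ∀ l, ‖b l‖ ≤ C * ρ ^ l := by
  obtain ⟨L, hL, hA⟩ := exists_norm_mulVec_le A
  have hρ : 1 ≤ max 1 L := le_max_left _ _
  have hC : 0 ≤ ∑ j ∈ Finset.range N, ‖b j‖ := Finset.sum_nonneg fun _ _ => norm_nonneg _
  refine ⟨∑ j ∈ Finset.range N, ‖b j‖, max 1 L, by positivity, fun l => ?_⟩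
  induction l using Nat.strong_induction_on with
  | _ l ih =>
    rcases lt_or_ge l N with h | h
    · refine (Finset.single_le_sum (f := fun j => ‖b j‖) (fun _ _ => norm_nonneg _)
        (Finset.mem_range.mpr h)).trans (le_mul_of_one_le_right hC (one_le_pow₀ hρ))
    · obtain ⟨k, rfl⟩ := Nat.exists_eq_add_of_le' h
      -- One application of `A` costs a factor `L` and advances the index by `N`, so `ρ = max 1 L`
      -- is large enough.
      have h1 : L ≤ max 1 L ^ N := (le_max_right 1 L).trans (le_self_pow₀ hρ hN)
      calc ‖b (k + N)‖ ≤ L * ‖b k‖ := by rw [hb]; exact hA _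
        _ ≤ max 1 L ^ N * ((∑ j ∈ Finset.range N, ‖b j‖) * max 1 L ^ k) :=
          mul_le_mul h1 (ih k (by omega)) (norm_nonneg _) (by positivity)
        _ = _ := by rw [pow_add]; ring

theorem differentiable_one_sub_pow_smul {κ : Type} [DecidableEq κ] (N : ℕ) (A : Matrix κ κ ℂ) (i j : κ) :
    Differentiable ℂ fun z : ℂ => (1 - z ^ N • A) i j := by
  simp only [Matrix.sub_apply, Matrix.smul_apply, smul_eq_mul]
  fun_prop

variable [DecidableEq ι]

/-- The determinant of `1 - ζ ^ N A`. -/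
noncomputable def resolventDen (N : ℕ) (A : Matrix ι ι ℂ) (ζ : ℂ) : ℂ := (1 - ζ ^ N • A).det

/-- The numerators of the solution `x` of `(1 - ζ ^ N A) x = ∑_{l < N} ζ ^ l b_l`. -/
noncomputable def resolventNum (N : ℕ) (A : Matrix ι ι ℂ) (b : ℕ → ι → ℂ) (ζ : ℂ) : ι → ℂ :=
  (1 - ζ ^ N • A).adjugate *ᵥ ∑ l ∈ Finset.range N, ζ ^ l • b l

theorem differentiable_det {M : ℂ → Matrix ι ι ℂ} (hM : ∀ i j, Differentiable ℂ fun z => M z i j) :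
    Differentiable ℂ fun z => (M z).det := by
  simp only [Matrix.det_apply]
  refine Differentiable.fun_sum fun σ _ => Differentiable.const_smul ?_ _
  exact Differentiable.fun_finsetProd fun i _ => hM _ _

theorem differentiable_resolventDen (N : ℕ) (A : Matrix ι ι ℂ) :
    Differentiable ℂ (resolventDen N A) :=
  differentiable_det (differentiable_one_sub_pow_smul N A)

theorem differentiable_resolventNum (N : ℕ) (A : Matrix ι ι ℂ) (b : ℕ → ι → ℂ) (i : ι) :
    Differentiable ℂ fun ζ => resolventNum N A b ζ i := by
  simp only [resolventNum, Matrix.mulVec, dotProduct, Matrix.adjugate_apply, Finset.sum_apply,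
    Pi.smul_apply, smul_eq_mul]
  refine Differentiable.fun_sum fun j _ => Differentiable.fun_mul (differentiable_det fun k l => ?_)
    (by fun_prop)
  by_cases h : k = j
  · subst h
    simp only [Matrix.updateRow_self]
    fun_prop
  · simp only [Matrix.updateRow_ne h]
    exact differentiable_one_sub_pow_smul N A k l

theorem resolventDen_zero (hN : N ≠ 0) : resolventDen N A 0 = 1 := by
  simp [resolventDen, hN]

theorem finite_setOf_pow_mem (hN : N ≠ 0) {S : Set ℂ} (hS : S.Finite) :
    {ζ : ℂ | ζ ^ N ∈ S}.Finite := by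
  refine hS.preimage' fun a _ => ?_
  refine (Polynomial.nthRootsFinset N a).finite_toSet.subset fun ζ hζ => ?_
  exact (Polynomial.mem_nthRootsFinset (Nat.pos_of_ne_zero hN) a).mpr hζ

/-- At a zero, `ζ ≠ 0` and `ζ^(-N)` is an eigenvalue of `A`; there are finitely many eigenvalues and
each has finitely many roots. -/
theorem finite_zeros_resolventDen (hN : N ≠ 0) (A : Matrix ι ι ℂ) :
    {ζ | resolventDen N A ζ = 0}.Finite := by
  refine (finite_setOf_pow_mem hN ((Matrix.finite_spectrum A).image Inv.inv)).subset fun ζ hζ => ?_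
  have hζ : resolventDen N A ζ = 0 := hζ
  have h0 : ζ ^ N ≠ 0 := by
    intro h
    simp [resolventDen, h] at hζ
  refine ⟨(ζ ^ N)⁻¹, ?_, inv_inv _⟩
  rw [spectrum.mem_iff, Matrix.isUnit_iff_isUnit_det, isUnit_iff_ne_zero, not_not,
    Algebra.algebraMap_eq_smul_one]
  have h1 : (ζ ^ N)⁻¹ • (1 : Matrix ι ι ℂ) - A = (ζ ^ N)⁻¹ • (1 - ζ ^ N • A) := by
    rw [smul_sub, inv_smul_smul₀ h0]
  rw [h1, Matrix.det_smul]
  exact mul_eq_zero_of_right _ hζ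

/-- Cramer's rule, in the fixed-point form `x = P + ζ^N A x` on which the Laplace transform acts. -/
theorem resolvent_eq {ζ : ℂ} (h : resolventDen N A ζ ≠ 0) :
    (fun i => resolventNum N A b ζ i / resolventDen N A ζ) =
      ∑ l ∈ Finset.range N, ζ ^ l • b l +
        ζ ^ N • A *ᵥ fun i => resolventNum N A b ζ i / resolventDen N A ζ := by
  have h1 : (fun i => resolventNum N A b ζ i / resolventDen N A ζ) =
      (resolventDen N A ζ)⁻¹ • resolventNum N A b ζ := by
    ext i
    rw [Pi.smul_apply, smul_eq_mul, div_eq_inv_mul]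
  have h2 : (1 - ζ ^ N • A) *ᵥ resolventNum N A b ζ =
      resolventDen N A ζ • ∑ l ∈ Finset.range N, ζ ^ l • b l := by
    rw [resolventNum, Matrix.mulVec_mulVec, Matrix.mul_adjugate, Matrix.smul_mulVec,
      Matrix.one_mulVec, resolventDen]
  rw [← sub_eq_iff_eq_add, h1, ← Matrix.smul_mulVec, Matrix.mulVec_smul, ← smul_sub]
  rw [Matrix.sub_mulVec, Matrix.one_mulVec] at h2
  rw [h2, inv_smul_smul₀ h]

theorem eq_resolvent_of_eq {ζ : ℂ} (h : resolventDen N A ζ ≠ 0) {x : ι → ℂ}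
    (hx : x = ∑ l ∈ Finset.range N, ζ ^ l • b l + ζ ^ N • A *ᵥ x) (i : ι) :
    x i = resolventNum N A b ζ i / resolventDen N A ζ := by
  have h1 : (1 - ζ ^ N • A) *ᵥ x = ∑ l ∈ Finset.range N, ζ ^ l • b l := by
    rw [Matrix.sub_mulVec, Matrix.one_mulVec, Matrix.smul_mulVec, sub_eq_iff_eq_add]
    exact hx
  rw [eq_div_iff h, resolventNum, ← h1, Matrix.mulVec_mulVec, Matrix.adjugate_mul,
    Matrix.smul_mulVec, Matrix.one_mulVec, Pi.smul_apply, smul_eq_mul, resolventDen, mul_comm]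

/-- Splitting off the first `N` terms shows that the generating function solves the fixed-point
equation, whose solution is unique where the determinant is nonzero. -/
theorem isSumNearZero_resolvent (hN : N ≠ 0) (hb : ∀ l, b (l + N) = A *ᵥ b l) (i : ι)
    {F : PowerSeries ℂ} (hF : ∀ l, PowerSeries.coeff l F = b l i) :
    IsSumNearZero F fun ζ => resolventNum N A b ζ i / resolventDen N A ζ := by
  obtain ⟨C, ρ, hρ, hC⟩ := exists_geometric_bound hN hb
  have hden : ∀ᶠ ζ in 𝓝 (0 : ℂ), resolventDen N A ζ ≠ 0 :=
    (differentiable_resolventDen N A).continuous.continuousAt.eventually_ne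
      (by rw [resolventDen_zero hN]; exact one_ne_zero)
  obtain ⟨r, hr, hrden⟩ := Metric.eventually_nhds_iff.mp hden
  refine ⟨min r ρ⁻¹, by positivity, fun ζ hζ => ?_⟩
  have hs (j : ι) : Summable fun l => b l j * ζ ^ l := by
    have h1 : ρ * ‖ζ‖ < 1 := by
      have := hζ.trans_le (min_le_right _ _)
      rwa [← one_div, lt_div_iff₀' hρ] at this
    refine Summable.of_norm_bounded
      ((summable_geometric_of_lt_one (by positivity) h1).mul_left C) fun l => ?_
    rw [norm_mul, norm_pow, mul_pow, ← mul_assoc]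
    exact mul_le_mul_of_nonneg_right ((norm_le_pi_norm _ _).trans (hC l)) (by positivity)
  have hx : (fun j => ∑' l, b l j * ζ ^ l) = ∑ l ∈ Finset.range N, ζ ^ l • b l +
      ζ ^ N • A *ᵥ fun j => ∑' l, b l j * ζ ^ l := by
    ext j
    rw [← (hs j).sum_add_tsum_nat_add N, Pi.add_apply, Finset.sum_apply]
    congr 1
    · exact Finset.sum_congr rfl fun l _ => by rw [Pi.smul_apply, smul_eq_mul, mul_comm]
    · simp only [hb, Pi.smul_apply, smul_eq_mul, Matrix.mulVec, dotProduct]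
      have h1 : HasSum (fun l => ∑ k, A j k * (b l k * ζ ^ l))
          (∑ k, A j k * ∑' l, b l k * ζ ^ l) :=
        hasSum_sum fun k _ => (hs k).hasSum.mul_left _
      rw [← (h1.mul_left (ζ ^ N)).tsum_eq]
      refine tsum_congr fun l => ?_
      rw [pow_add, Finset.sum_mul, Finset.mul_sum]
      exact Finset.sum_congr rfl fun k _ => by ring
  have := eq_resolvent_of_eq
    (hrden (by rw [dist_zero_right]; exact hζ.trans_le (min_le_left _ _))) hx i
  simp only [hF]
  rw [← this]
  exact (hs i).hasSum

/-- Invertibility of `A` gives `ζ^N x = A⁻¹ (x - P)`, where `P` has degree below `N`; so `x` cannot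
grow. -/
theorem exists_bound_resolvent (hN : N ≠ 0) (hA : IsUnit A) (b : ℕ → ι → ℂ) (i : ι) :
    ∃ R M : ℝ, ∀ ζ, R < ‖ζ‖ → ‖resolventNum N A b ζ i / resolventDen N A ζ‖ ≤ M := by
  obtain ⟨L, hL, hAL⟩ := exists_norm_mulVec_le A⁻¹
  have hdet : IsUnit A.det := (Matrix.isUnit_iff_isUnit_det A).mp hA
  set S := ∑ l ∈ Finset.range N, ‖b l‖ with hS
  have hS0 : 0 ≤ S := Finset.sum_nonneg fun _ _ => norm_nonneg _
  refine ⟨max 1 (2 * L), S, fun ζ hζ => ?_⟩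
  -- At a zero of the denominator the quotient is `0` by convention, so the bound needs no
  -- restriction on `ζ`.
  by_cases h0 : resolventDen N A ζ = 0
  · rw [h0, div_zero, norm_zero]
    exact hS0
  have hζ1 : 1 < ‖ζ‖ := (le_max_left _ _).trans_lt hζ
  have hζ2 : 2 * L < ‖ζ‖ := (le_max_right _ _).trans_lt hζ
  have hx := resolvent_eq (b := b) h0
  set x : ι → ℂ := fun i => resolventNum N A b ζ i / resolventDen N A ζ
  refine (norm_le_pi_norm x i).trans ?_
  set P := ∑ l ∈ Finset.range N, ζ ^ l • b l with hP
  have hPS : ‖P‖ ≤ ‖ζ‖ ^ (N - 1) * S := by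
    rw [hP, hS, Finset.mul_sum]
    refine norm_sum_le_of_le _ fun l hl => ?_
    rw [norm_smul, norm_pow]
    refine mul_le_mul_of_nonneg_right (pow_le_pow_right₀ hζ1.le ?_) (norm_nonneg _)
    have := Finset.mem_range.mp hl
    omega
  have h1 : ζ ^ N • x = A⁻¹ *ᵥ (x - P) := by
    rw [sub_eq_iff_eq_add'.mpr hx, Matrix.mulVec_smul, Matrix.mulVec_mulVec,
      Matrix.nonsing_inv_mul _ hdet, Matrix.one_mulVec]
  have h2 : ‖ζ‖ ^ N * ‖x‖ ≤ L * (‖x‖ + ‖ζ‖ ^ (N - 1) * S) := by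
    rw [← norm_pow, ← norm_smul, h1]
    exact (hAL _).trans (mul_le_mul_of_nonneg_left ((norm_sub_le _ _).trans (by linarith)) hL)
  obtain ⟨n, rfl⟩ := Nat.exists_eq_succ_of_ne_zero hN
  rw [Nat.succ_sub_one, pow_succ] at h2
  have h3 : 1 ≤ ‖ζ‖ ^ n := one_le_pow₀ hζ1.le
  set y := ‖ζ‖ ^ n
  have h4 : L * ‖x‖ ≤ L * (y * ‖x‖) :=
    mul_le_mul_of_nonneg_left (le_mul_of_one_le_left (norm_nonneg _) h3) hL
  -- After cancelling `y`, the inequality `‖ζ‖ > 2L` makes `‖ζ‖ - L` at least `‖ζ‖/2` and `L` at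
  -- most `‖ζ‖/2`; this leaves `‖x‖ ≤ S`.
  have h5 : y * ((‖ζ‖ - L) * ‖x‖) ≤ y * (L * S) := by nlinarith
  have h6 := le_of_mul_le_mul_left h5 (by linarith)
  have h7 : (‖ζ‖ / 2) * ‖x‖ ≤ (‖ζ‖ / 2) * S :=
    (mul_le_mul_of_nonneg_right (by linarith) (norm_nonneg _)).trans
      (h6.trans (mul_le_mul_of_nonneg_right (by linarith) hS0))
  exact le_of_mul_le_mul_left h7 (by linarith)

theorem isSpiralQuotient_resolvent {p lam : ℂ} (hN : N ≠ 0) (hA : IsUnit A) (b : ℕ → ι → ℂ)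
    (hsp : ∀ l : ℤ, resolventDen N A (p ^ l * lam) ≠ 0) (i : ι) :
    IsSpiralQuotient p lam (fun ζ => resolventNum N A b ζ i) (resolventDen N A) where
  differentiable_num := differentiable_resolventNum N A b i
  differentiable_den := differentiable_resolventDen N A
  finite_zeros := finite_zeros_resolventDen hN A
  den_zero := by rw [resolventDen_zero hN]; exact one_ne_zero
  den_spiral := hsp
  bounded := exists_bound_resolvent hN hA b i

end Resolvent

/-! ### The Laplace transform carries the Borel equation back to the q-difference equation -/

section System

variable {q τ : ℂ} {N : ℕ}

theorem qpow_neg_triangular (hN : N ≠ 0) (j : ℕ) :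
    qpow τ (-((j : ℂ) * ((j : ℂ) - 1)) / (2 * (N : ℂ))) = qpow τ (1 / N) ^ (-tri (j - 1)) := by
  have hN' : (N : ℂ) ≠ 0 := Nat.cast_ne_zero.mpr hN
  have h : 2 * ((tri (j - 1) : ℤ) : ℂ) = (j - 1) * j := by
    have := congrArg (Int.cast (R := ℂ)) (two_mul_tri (j - 1))
    push_cast at this
    rw [this]
    ring
  rw [← qpow_intCast_mul]
  congr 1
  push_cast
  field_simp
  linear_combination h

/-- The constant in the definition of `Σ` is the Borel factor of index `N`, the factor `κ` of the
constant recursion. -/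
theorem qpow_neg_half (hN : N ≠ 0) :
    qpow τ (-((N : ℂ) - 1) / 2) = qpow τ (1 / N) ^ (-tri (N - 1)) := by
  have hN' : (N : ℂ) ≠ 0 := Nat.cast_ne_zero.mpr hN
  rw [← qpow_neg_triangular hN]
  congr 1
  field_simp

variable {ι : Type} [Fintype ι] [DecidableEq ι] {p lam : ℂ} {Φ : Matrix ι ι ℂ} {b : ℕ → ι → ℂ}

/-- The `q`-Laplace transform of the solution of `(1 - ζ ^ N A) x = ∑_{l < N} ζ ^ l b_l`. -/
noncomputable def laplaceResolvent (p lam : ℂ) (N : ℕ) (A : Matrix ι ι ℂ) (b : ℕ → ι → ℂ) (z : ℂ) :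
    ι → ℂ :=
  fun i => laplaceQuotient p lam (fun ζ => resolventNum N A b ζ i / resolventDen N A ζ) z

theorem theta_pow_mul (hp : 1 < ‖p‖) (j : ℕ) {w : ℂ} (hw : w ≠ 0) :
    theta p (p ^ j * w) = p ^ tri (j - 1) * w ^ j * theta p w := by
  have := theta_zpow_mul hp ((j : ℤ) - 1) hw
  rwa [sub_add_cancel, zpow_natCast, zpow_natCast] at this

/-- At each spiral point the Borel transform satisfies its fixed-point equation. Weighting by
`p^(-tri l) w^l` and summing turns the factor `ζ^j` into `lam^j` and the substitution `w ↦ p^j w`;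
the functional equation of Theta then cancels the Borel factor and produces `z^j`. -/
theorem laplaceResolvent_eq (hp : 1 < ‖p‖) (hN : N ≠ 0) (hΦ : IsUnit Φ) (hlam : lam ≠ 0)
    (h : ℕ → ι → ℂ)
    (hsp : ∀ l : ℤ, resolventDen N (p ^ (-tri (N - 1)) • Φ) (p ^ l * lam) ≠ 0) {z : ℂ} (hz : z ≠ 0)
    (hθ : theta p (z / lam) ≠ 0) :
    laplaceResolvent p lam N (p ^ (-tri (N - 1)) • Φ) (fun l => p ^ (-tri (l - 1)) • h l) z =
      ∑ l ∈ Finset.range N, z ^ l • h l + z ^ N • Φ *ᵥ laplaceResolvent p lam N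
        (p ^ (-tri (N - 1)) • Φ) (fun l => p ^ (-tri (l - 1)) • h l) (p ^ N * z) := by
  have hp0 := ne_zero_of_one_lt_norm hp
  set κ := p ^ (-tri (N - 1)) with hκ
  set b : ℕ → ι → ℂ := fun l => p ^ (-tri (l - 1)) • h l with hb
  have hA : IsUnit (κ • Φ) := by
    rw [Matrix.isUnit_iff_isUnit_det, Matrix.det_smul]
    exact ((zpow_ne_zero _ hp0).isUnit.pow _).mul ((Matrix.isUnit_iff_isUnit_det _).mp hΦ)
  have hQ (i : ι) := isSpiralQuotient_resolvent hN hA b hsp i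
  choose M hM using fun i => (hQ i).exists_bound_spiral hp hlam
  set v : ℤ → ι → ℂ := fun l i =>
    resolventNum N (κ • Φ) b (p ^ l * lam) i / resolventDen N (κ • Φ) (p ^ l * lam) with hv
  have hveq (l : ℤ) (i : ι) : v l i = ∑ j ∈ Finset.range N, (p ^ l * lam) ^ j * b j i +
      (p ^ l * lam) ^ N * (κ * ∑ k, Φ i k * v l k) := by
    have := congrFun (resolvent_eq (b := b) (hsp l)) i
    rw [Pi.add_apply, Finset.sum_apply, Pi.smul_apply, Matrix.smul_mulVec, Pi.smul_apply] at this
    exact this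
  set w := z / lam with hw
  have hw0 : w ≠ 0 := div_ne_zero hz hlam
  have hwq : p ^ N * z / lam = p ^ N * w := by rw [hw, mul_div_assoc]
  -- The equation for the numerators, before division by `Θ_p(w)`: the polynomial part gives Theta
  -- itself, the `ζ^N` part the same series at `p^N w`.
  have hG (i : ι) : thetaSeries (fun l => v l i) p w =
      ∑ j ∈ Finset.range N, lam ^ j * b j i * theta p (p ^ j * w) +
        κ * lam ^ N * ∑ k, Φ i k * thetaSeries (fun l => v l k) p (p ^ N * w) := by
    refine (hasSum_thetaSeries (hM i) hp hw0).unique ?_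
    have h1 : HasSum (fun l : ℤ => ∑ j ∈ Finset.range N,
        lam ^ j * b j i * (p ^ (-tri l) * (p ^ j * w) ^ l))
        (∑ j ∈ Finset.range N, lam ^ j * b j i * theta p (p ^ j * w)) :=
      hasSum_sum fun j _ => (hasSum_theta hp (mul_ne_zero (pow_ne_zero _ hp0) hw0)).mul_left _
    have h2 : HasSum (fun l : ℤ => κ * lam ^ N *
        ∑ k, Φ i k * (v l k * (p ^ (-tri l) * (p ^ N * w) ^ l)))
        (κ * lam ^ N * ∑ k, Φ i k * thetaSeries (fun l => v l k) p (p ^ N * w)) :=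
      (hasSum_sum fun k _ => (hasSum_thetaSeries (hM k) hp
        (mul_ne_zero (pow_ne_zero _ hp0) hw0)).mul_left (Φ i k)).mul_left _
    refine (h1.add h2).congr_fun fun l => ?_
    have hpow (j : ℕ) : (p ^ l * lam) ^ j = lam ^ j * (p ^ j) ^ l := by
      rw [mul_pow, mul_comm, ← zpow_natCast (p ^ l) j, ← zpow_natCast p j, ← zpow_mul, ← zpow_mul, mul_comm l]
    change v l i * _ = _
    rw [hveq, add_mul]
    congr 1
    · rw [Finset.sum_mul]
      refine Finset.sum_congr rfl fun j _ => ?_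
      rw [hpow, mul_zpow]
      ring
    · rw [hpow, Finset.mul_sum, Finset.mul_sum, Finset.sum_mul, Finset.mul_sum]
      refine Finset.sum_congr rfl fun k _ => ?_
      rw [mul_zpow]
      ring
  ext i
  have hzw : lam * w = z := mul_div_cancel₀ _ hlam
  rw [Pi.add_apply, Finset.sum_apply, Pi.smul_apply]
  change thetaSeries (fun l => v l i) p w / theta p w = _ + z ^ N *
    ∑ k, Φ i k * (thetaSeries (fun l => v l k) p (p ^ N * z / lam) / theta p (p ^ N * z / lam))
  rw [hwq, hG i, add_div]
  congr 1
  · rw [Finset.sum_div]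
    refine Finset.sum_congr rfl fun j _ => ?_
    rw [theta_pow_mul hp j hw0, hb, Pi.smul_apply, smul_eq_mul]
    simp only [Pi.smul_apply, smul_eq_mul]
    rw [zpow_neg, ← hzw, mul_pow lam w]
    have : p ^ tri (j - 1) ≠ 0 := zpow_ne_zero _ hp0
    field_simp
  · rw [theta_pow_mul hp N hw0, Finset.mul_sum, Finset.mul_sum, Finset.sum_div]
    refine Finset.sum_congr rfl fun k _ => ?_
    rw [hκ, zpow_neg, ← hzw, mul_pow lam w]
    have : p ^ tri (N - 1) ≠ 0 := zpow_ne_zero _ hp0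
    field_simp

/-- The numerator is analytic on `ℂ*`, and the denominator has only simple zeros, all on `-lam p^ℤ`.
-/
theorem IsSpiralQuotient.meromorphicOrderAt_laplaceQuotient {num den : ℂ → ℂ}
    (h : IsSpiralQuotient p lam num den) (hp : 1 < ‖p‖) (hlam : lam ≠ 0) {w : ℂ} (hw : w ≠ 0) :
    (-1 : ℤ) ≤ meromorphicOrderAt (laplaceQuotient p lam fun ζ => num ζ / den ζ) w ∧
      ((∀ l : ℤ, w ≠ -(p ^ l * lam)) →
        0 ≤ meromorphicOrderAt (laplaceQuotient p lam fun ζ => num ζ / den ζ) w) := by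
  have hG : AnalyticAt ℂ (fun z => thetaSeries
      (fun l => num (p ^ l * lam) / den (p ^ l * lam)) p (z / lam)) w :=
    (h.analyticAt_thetaSeries hp hlam (div_ne_zero hw hlam)).comp_of_eq (analyticAt_div_const w lam)
      rfl
  have hθ := analyticAt_theta_div hp hlam hw
  have horder : meromorphicOrderAt (laplaceQuotient p lam fun ζ => num ζ / den ζ) w =
      meromorphicOrderAt (fun z => thetaSeries
        (fun l => num (p ^ l * lam) / den (p ^ l * lam)) p (z / lam)) w -
      meromorphicOrderAt (fun z => theta p (z / lam)) w :=
    meromorphicOrderAt_div hG.meromorphicAt hθ.meromorphicAt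
  have h0 := hG.meromorphicOrderAt_nonneg
  rw [horder]
  generalize meromorphicOrderAt (fun z => thetaSeries
    (fun l => num (p ^ l * lam) / den (p ^ l * lam)) p (z / lam)) w = m at h0 ⊢
  rw [ hθ.meromorphicOrderAt_eq]
  by_cases h1 : theta p (w / lam) = 0
  · rw [hθ.analyticOrderAt_eq_one_of_zero_deriv_ne_zero h1 (deriv_theta_div_ne_zero hp hlam hw h1)]
    refine ⟨?_, fun h2 => ?_⟩
    · change (-1 : ℤ) ≤ m - ((1 : ℤ) : WithTop ℤ)
      induction m using WithTop.recTopCoe with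
      | top => exact le_top
      | coe m =>
        norm_cast at h0 ⊢
        omega
    · obtain ⟨k, hk⟩ := exists_eq_neg_zpow_of_theta_eq_zero hp (div_ne_zero hw hlam) h1
      exact (h2 k (by rw [← neg_mul, ← hk, div_mul_cancel₀ _ hlam])).elim
  · rw [hθ.analyticOrderAt_eq_zero.mpr h1]
    have h2 : m - (ENat.map (↑) 0 : WithTop ℤ) = m := sub_zero m
    rw [h2]
    exact ⟨le_trans (by norm_cast) h0, fun _ => h0⟩

/-- Multiplication by the Theta function removes simple poles on the spiral. -/
theorem meromorphicOrderAt_theta_mul_nonneg (hp : 1 < ‖p‖) (hlam : lam ≠ 0) {f : ℂ → ℂ} {w : ℂ}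
    (hw : w ≠ 0) (hf : MeromorphicAt f w) (h1 : (-1 : ℤ) ≤ meromorphicOrderAt f w)
    (h2 : (∀ l : ℤ, w ≠ -(p ^ l * lam)) → 0 ≤ meromorphicOrderAt f w) :
    0 ≤ meromorphicOrderAt (fun z => theta p (z / lam) * f z) w := by
  have hθ := analyticAt_theta_div hp hlam hw
  have horder : meromorphicOrderAt (fun z => theta p (z / lam) * f z) w =
      meromorphicOrderAt (fun z => theta p (z / lam)) w + meromorphicOrderAt f w :=
    meromorphicOrderAt_mul hθ.meromorphicAt hf
  rw [horder]
  by_cases h : theta p (w / lam) = 0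
  · rw [hθ.meromorphicOrderAt_eq, hθ.analyticOrderAt_eq_one_of_zero_deriv_ne_zero h
      (deriv_theta_div_ne_zero hp hlam hw h)]
    generalize meromorphicOrderAt f w = m at h1 ⊢
    change 0 ≤ ((1 : ℤ) : WithTop ℤ) + m
    induction m using WithTop.recTopCoe with
    | top => exact le_top
    | coe m =>
      norm_cast at h1 ⊢
      omega
  · refine add_nonneg hθ.meromorphicOrderAt_nonneg (h2 fun l hl => h ?_)
    rw [hl, neg_div, mul_div_assoc, div_self hlam, mul_one, theta_neg_zpow hp]

/-! ### Uniqueness: the homogeneous equation and Laurent coefficients -/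

theorem circleIntegrable_laurent {V : ℂ → ℂ} {R r : ℝ} (hr : 0 < r) (hR : r < R)
    (hV : DifferentiableOn ℂ V {z | 0 < ‖z‖ ∧ ‖z‖ < R}) (k : ℤ) :
    CircleIntegrable (fun z => V z * z ^ (-k)) 0 r := by
  refine ContinuousOn.circleIntegrable hr.le fun z hz => ?_
  have hz' : ‖z‖ = r := mem_sphere_zero_iff_norm.mp hz
  have hz0 : z ≠ 0 := norm_pos_iff.mp (by rw [hz']; exact hr)
  have h1 := (hV.differentiableAt ((isOpen_puncturedBall R).mem_nhds
    ⟨by rw [hz']; exact hr, by rw [hz']; exact hR⟩)).continuousAt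
  exact (h1.mul (continuousAt_zpow₀ z (-k) (Or.inl hz0))).continuousWithinAt

theorem laurentCoeff_sum_mul {κ : Type} [Fintype κ] {V : ℂ → κ → ℂ} {R r : ℝ} (hr : 0 < r) (hR : r < R)
    (hV : ∀ i, DifferentiableOn ℂ (fun z => V z i) {z | 0 < ‖z‖ ∧ ‖z‖ < R}) (c : κ → ℂ) (k : ℤ) :
    laurentCoeff (fun z => ∑ i, c i * V z i) r k = ∑ i, c i * laurentCoeff (fun z => V z i) r k := by
  have h1 : (fun z => (∑ i, c i * V z i) * z ^ (-k)) =
      fun z => ∑ i, c i • (V z i * z ^ (-k)) := by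
    funext z
    rw [Finset.sum_mul]
    exact Finset.sum_congr rfl fun i _ => by rw [smul_eq_mul, mul_assoc]
  rw [laurentCoeff, h1, Real.circleAverage_fun_sum]
  · refine Finset.sum_congr rfl fun i _ => ?_
    rw [Real.circleAverage_fun_smul, smul_eq_mul, laurentCoeff]
  · exact fun i _ => (circleIntegrable_laurent hr hR (hV i) k).const_fun_smul

theorem eventually_comp_mul {P : ℂ → Prop} {q w : ℂ} (hq : q ≠ 0) (h : ∀ᶠ z in 𝓝[≠] (q * w), P z) :
    ∀ᶠ z in 𝓝[≠] w, P (q * z) := by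
  have ht : Tendsto (fun z : ℂ => q * z) (𝓝[≠] w) (𝓝[≠] (q * w)) := by
    refine tendsto_nhdsWithin_iff.mpr ⟨?_, ?_⟩
    · exact (continuous_const_mul q).continuousAt.tendsto.mono_left nhdsWithin_le_nhds
    · filter_upwards [self_mem_nhdsWithin] with z hz h0
      exact hz (mul_left_cancel₀ hq h0)
  exact ht.eventually h

/-- A holomorphic solution near `0` of `V(z) = t Φ V(q z)` vanishes if `t q ^ k Φ` never has the
eigenvalue `1`. -/
theorem eq_zero_of_holomorphic_homogeneous {q t : ℂ} (hq : 1 < ‖q‖) {R : ℝ} {V : ℂ → ι → ℂ}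
    (hV : ∀ i, DifferentiableOn ℂ (fun z => V z i) {z | 0 < ‖z‖ ∧ ‖z‖ < R})
    (heq : ∀ z, 0 < ‖z‖ → ‖q‖ * ‖z‖ < R → V z = t • Φ *ᵥ V (q * z))
    (hdet : ∀ k : ℤ, (1 - (t * q ^ k) • Φ).det ≠ 0) {z : ℂ} (hz : 0 < ‖z‖) (hzR : ‖q‖ * ‖z‖ < R) :
    V z = 0 := by
  have hq0 := ne_zero_of_one_lt_norm hq
  have hzq : ‖z‖ ≤ ‖q‖ * ‖z‖ := le_mul_of_one_le_left (norm_nonneg _) hq.le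
  have hcoef (k : ℤ) : (fun i => laurentCoeff (fun z => V z i) ‖z‖ k) = 0 := by
    set a : ι → ℂ := fun i => laurentCoeff (fun z => V z i) ‖z‖ k with ha
    -- The coefficient of `V(q z)` is `q^k` times that of `V` on the larger circle, which equals `a`
    -- by Cauchy's theorem.
    have h1 : a = (t * q ^ k) • Φ *ᵥ a := by
      ext i
      have h2 : a i = laurentCoeff (fun u => (fun v => ∑ j, t * Φ i j * V v j) (q * u)) ‖z‖ k := by
        refine Real.circleAverage_congr_sphere fun u hu => ?_
        have hu' : ‖u‖ = ‖z‖ := by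
          rw [mem_sphere_zero_iff_norm.mp hu, abs_norm]
        have h3 := congrFun (heq u (by rw [hu']; exact hz) (by rw [hu']; exact hzR)) i
        simp only [h3, Pi.smul_apply, smul_eq_mul, Matrix.mulVec, dotProduct, Finset.mul_sum,
          mul_assoc]
      rw [h2, laurentCoeff_comp_mul (fun v => ∑ j, t * Φ i j * V v j) hq0, laurentCoeff_sum_mul (hz.trans_le hzq) hzR hV]
      simp only [← laurentCoeff_eq_of_differentiableOn hz hzq hzR (hV _) k, Pi.smul_apply,
        smul_eq_mul, Matrix.mulVec, dotProduct, Finset.mul_sum, ha]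
      exact Finset.sum_congr rfl fun j _ => by ring
    by_contra hne
    refine hdet k (Matrix.exists_mulVec_eq_zero_iff.mp ⟨a, hne, ?_⟩)
    rw [Matrix.sub_mulVec, Matrix.one_mulVec, Matrix.smul_mulVec, ← h1, sub_self]
  ext i
  refine eq_zero_of_laurentCoeff_eq_zero hz (fun u hu => ?_) (fun k => congrFun (hcoef k) i) rfl
  have hu' : ‖u‖ = ‖z‖ := mem_sphere_zero_iff_norm.mp hu
  exact ((hV i).differentiableAt ((isOpen_puncturedBall R).mem_nhds
    ⟨by rw [hu']; exact hz, by rw [hu']; exact hzq.trans_lt hzR⟩)).continuousAt.continuousWithinAt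

/-- Multiplication by `Θ_p(z / lam)` removes the permitted poles and, by its quasi-periodicity under
`p^N`, replaces `z^N Φ` by the constant matrix `κ lam^N Φ`. The problem becomes one on Laurent
coefficients. -/
theorem eventually_eq_zero_of_homogeneous (hp : 1 < ‖p‖) (hN : N ≠ 0) (hlam : lam ≠ 0)
    (hsp : ∀ l : ℤ, resolventDen N (p ^ (-tri (N - 1)) • Φ) (p ^ l * lam) ≠ 0) {Y : ℂ → ι → ℂ}
    (hY : ∀ i, MeromorphicOn (fun z => Y z i) {0}ᶜ)
    (heq : ∀ w, w ≠ 0 → ∀ᶠ z in 𝓝[≠] w, Y z = z ^ N • Φ *ᵥ Y (p ^ N * z))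
    (hpoles : ∃ r : ℝ, 0 < r ∧ ∀ w : ℂ, 0 < ‖w‖ → ‖w‖ < r → ∀ i,
      (-1 : ℤ) ≤ meromorphicOrderAt (fun z => Y z i) w ∧
      ((∀ l : ℤ, w ≠ -(p ^ l * lam)) → 0 ≤ meromorphicOrderAt (fun z => Y z i) w))
    {w : ℂ} (hw : w ≠ 0) (i : ι) : ∀ᶠ z in 𝓝[≠] w, Y z i = 0 := by
  have hp0 := ne_zero_of_one_lt_norm hp
  have hpN0 : p ^ N ≠ 0 := pow_ne_zero _ hp0
  have hpN : 1 < ‖p ^ N‖ := by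
    rw [norm_pow]
    exact one_lt_pow₀ hp hN
  obtain ⟨r, hr, hpoles⟩ := hpoles
  set κ := p ^ (-tri (N - 1)) with hκ
  set B : Set ℂ := {z | 0 < ‖z‖ ∧ ‖z‖ < r} with hB
  have hB0 {z : ℂ} (hz : z ∈ B) : z ≠ 0 := norm_pos_iff.mp hz.1
  set W : ι → ℂ → ℂ := fun i z => theta p (z / lam) * Y z i with hW
  have hWm (i : ι) : MeromorphicOn (W i) B := fun z hz =>
    (analyticAt_theta_div hp hlam (hB0 hz)).meromorphicAt.mul (hY i z (hB0 hz))
  -- Passing to the normal form corrects values at isolated points, so that nonnegative order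
  -- becomes genuine analyticity.
  set V : ℂ → ι → ℂ := fun z i => toMeromorphicNFOn (W i) B z with hVdef
  have hVW (i : ι) {z : ℂ} (hz : z ∈ B) : ∀ᶠ u in 𝓝[≠] z, W i u = V u i :=
    ((hWm i).toMeromorphicNFOn_eq_self_on_nhdsNE hz).symm
  have hVa (i : ι) {z : ℂ} (hz : z ∈ B) : AnalyticAt ℂ (fun z => V z i) z := by
    have h1 : MeromorphicNFAt (fun z => V z i) z := meromorphicNFOn_toMeromorphicNFOn (W i) B hz
    rw [← h1.meromorphicOrderAt_nonneg_iff_analyticAt, ← meromorphicOrderAt_congr (hVW i hz)]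
    obtain ⟨h2, h3⟩ := hpoles z hz.1 hz.2 i
    exact meromorphicOrderAt_theta_mul_nonneg hp hlam (hB0 hz) (hY i z (hB0 hz)) h2 h3
  have hVeq (z : ℂ) (hz : 0 < ‖z‖) (hzr : ‖p ^ N‖ * ‖z‖ < r) :
      V z = (κ * lam ^ N) • Φ *ᵥ V (p ^ N * z) := by
    have hz0 : z ≠ 0 := norm_pos_iff.mp hz
    have hzB : z ∈ B := ⟨hz, (le_mul_of_one_le_left (norm_nonneg _) hpN.le).trans_lt hzr⟩
    have hqzB : p ^ N * z ∈ B := ⟨norm_pos_iff.mpr (mul_ne_zero hpN0 hz0), by rwa [norm_mul]⟩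
    ext i
    have h1 : ContinuousAt (fun u => V u i) z := (hVa i hzB).continuousAt
    have h2 : ContinuousAt (fun u => ((κ * lam ^ N) • Φ *ᵥ V (p ^ N * u)) i) z := by
      simp only [Pi.smul_apply, smul_eq_mul, Matrix.mulVec, dotProduct]
      refine continuousAt_const.mul (tendsto_finsetSum _ fun j _ => tendsto_const_nhds.mul ?_)
      exact ContinuousAt.comp (f := fun u => p ^ N * u) (g := fun u => V u j) (hVa j hqzB).continuousAt
        (continuous_const_mul _).continuousAt
    refine tendsto_nhds_unique_of_eventuallyEq (h1.mono_left nhdsWithin_le_nhds)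
      (h2.mono_left nhdsWithin_le_nhds) (l := 𝓝[≠] z) ?_
    have h3 : ∀ᶠ u in 𝓝[≠] z, ∀ j, W j (p ^ N * u) = V (p ^ N * u) j :=
      eventually_all.mpr fun j => eventually_comp_mul hpN0 (hVW j hqzB)
    have h4 : ∀ᶠ u in 𝓝[≠] z, u ≠ 0 := (isOpen_ne.mem_nhds hz0 : {u | u ≠ 0} ∈ 𝓝 z) |>
      fun h => nhdsWithin_le_nhds h
    filter_upwards [hVW i hzB, h3, heq z hz0, h4] with u hu1 hu2 hu3 hu4
    have hul : u / lam ≠ 0 := div_ne_zero hu4 hlam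
    have h5 := congrFun hu3 i
    simp only [Pi.smul_apply, smul_eq_mul, Matrix.mulVec, dotProduct] at h5 ⊢
    rw [← hu1]
    simp only [← hu2, hW]
    rw [h5, mul_div_assoc, theta_pow_mul hp N hul, hκ, zpow_neg, div_pow, Finset.mul_sum, Finset.mul_sum,
      Finset.mul_sum]
    refine Finset.sum_congr rfl fun j _ => ?_
    have : p ^ tri (N - 1) ≠ 0 := zpow_ne_zero _ hp0
    field_simp
  have hV0 {z : ℂ} (hz : 0 < ‖z‖) (hzr : ‖p ^ N‖ * ‖z‖ < r) : V z = 0 := by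
    refine eq_zero_of_holomorphic_homogeneous hpN
      (fun i u hu => (hVa i hu).differentiableAt.differentiableWithinAt) hVeq (fun k => ?_) hz hzr
    -- The determinant for the `k`-th coefficient is the resolvent determinant at `p^k lam`, because
    -- `lam^N (p^N)^k = (p^k lam)^N`.
    have h1 := hsp k
    rw [resolventDen, smul_smul] at h1
    convert h1 using 4
    rw [mul_pow, mul_comm κ, mul_comm ((p ^ k) ^ N), mul_assoc, mul_assoc, mul_comm κ,
      ← zpow_natCast (p ^ k), ← zpow_natCast p N, ← zpow_mul, ← zpow_mul, mul_comm k]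
  -- Any point with `‖p^N‖ ‖w₀‖ < r` serves; vanishing near it extends to `ℂ*` by the identity
  -- theorem.
  set w₀ : ℂ := ((r / (2 * ‖p ^ N‖) : ℝ) : ℂ) with hw₀
  have hpN' : 0 < ‖p ^ N‖ := one_pos.trans hpN
  have hw₀n : ‖w₀‖ = r / (2 * ‖p ^ N‖) := by
    rw [hw₀, Complex.norm_real, Real.norm_of_nonneg (by positivity)]
  have hw₀0 : 0 < ‖w₀‖ := by
    rw [hw₀n]
    positivity
  have hw₀r : ‖p ^ N‖ * ‖w₀‖ < r := by
    rw [hw₀n]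
    field_simp
    norm_num
  refine eventuallyEq_of_meromorphicOn (hY i) (MeromorphicOn.const 0) (norm_pos_iff.mp hw₀0) ?_ hw
  have hw₀B : w₀ ∈ B := ⟨hw₀0, (le_mul_of_one_le_left (norm_nonneg _) hpN.le).trans_lt hw₀r⟩
  have h1 : ∀ᶠ u in 𝓝 w₀, 0 < ‖u‖ ∧ ‖p ^ N‖ * ‖u‖ < r :=
    ((isOpen_lt continuous_const continuous_norm).inter
      (isOpen_lt (continuous_norm.const_mul _) continuous_const)).mem_nhds ⟨hw₀0, hw₀r⟩
  filter_upwards [hVW i hw₀B, h1.filter_mono nhdsWithin_le_nhds,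
    eventually_theta_div_ne_zero hp hlam (hB0 hw₀B)] with u hu1 hu2 hu3
  rw [congrFun (hV0 hu2.1 hu2.2) i] at hu1
  exact (mul_eq_zero.mp hu1).resolve_left hu3

end System

/-! ### Spectra and the exceptional set -/

section Spectrum

variable {m₁ m₂ : ℕ} {C₁ : Matrix (Fin m₁) (Fin m₁) ℂ} {C₂ : Matrix (Fin m₂) (Fin m₂) ℂ}

theorem mul_aeval_eq_aeval_mul {M : Matrix (Fin m₁) (Fin m₂) ℂ} (h : M * C₂ = C₁ * M)
    (P : Polynomial ℂ) : M * Polynomial.aeval C₂ P = Polynomial.aeval C₁ P * M := by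
  have hpow (n : ℕ) : M * C₂ ^ n = C₁ ^ n * M := by
    induction n with
    | zero => simp
    | succ n ih => rw [pow_succ, pow_succ, ← Matrix.mul_assoc, ih, Matrix.mul_assoc, h, Matrix.mul_assoc]
  induction P using Polynomial.induction_on' with
  | add P Q hP hQ => rw [map_add, map_add, Matrix.mul_add, Matrix.add_mul, hP, hQ]
  | monomial n a =>
    rw [Polynomial.aeval_monomial, Polynomial.aeval_monomial, ← Algebra.smul_def,
      ← Algebra.smul_def, Matrix.mul_smul, hpow, Matrix.smul_mul]

/-- Intertwined matrices have a common eigenvalue. -/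
theorem exists_mem_spectrum_of_intertwining {M : Matrix (Fin m₁) (Fin m₂) ℂ} (hM : M ≠ 0)
    (h : M * C₂ = C₁ * M) : ∃ α, α ∈ spectrum ℂ C₁ ∧ α ∈ spectrum ℂ C₂ := by
  have hm : 0 < m₁ := by
    rcases Nat.eq_zero_or_pos m₁ with rfl | h0
    · exact (hM (Subsingleton.elim _ _)).elim
    · exact h0
  -- By Cayley–Hamilton `M χ(C₂) = 0` for `χ` the characteristic polynomial of `C₁`. Since `M ≠ 0`,
  -- `χ(C₂)` is singular and some eigenvalue of `C₂` is a root of `χ`.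
  have h1 := mul_aeval_eq_aeval_mul h C₁.charpoly
  rw [Matrix.aeval_self_charpoly, Matrix.zero_mul] at h1
  have h2 : (0 : ℂ) ∈ spectrum ℂ (Polynomial.aeval C₂ C₁.charpoly) := by
    rw [spectrum.zero_mem_iff]
    intro hu
    obtain ⟨u, hu⟩ := hu
    refine hM ?_
    calc M = M * ((u : Matrix (Fin m₂) (Fin m₂) ℂ) *
            ((u⁻¹ : (Matrix (Fin m₂) (Fin m₂) ℂ)ˣ) : Matrix (Fin m₂) (Fin m₂) ℂ)) := by
          rw [Units.mul_inv, Matrix.mul_one]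
      _ = 0 := by rw [← Matrix.mul_assoc, hu, h1, Matrix.zero_mul]
  rw [spectrum.map_polynomial_aeval_of_degree_pos] at h2
  · obtain ⟨α, hα, h0⟩ := h2
    exact ⟨α, Matrix.mem_spectrum_iff_isRoot_charpoly.mpr h0, hα⟩
  · rw [← Polynomial.natDegree_pos_iff_degree_pos, Matrix.charpoly_natDegree_eq_dim,
      Fintype.card_fin]
    exact hm

theorem mem_spectrum_smul {n : ℕ} {C : Matrix (Fin n) (Fin n) ℂ} {t α : ℂ} (ht : t ≠ 0)
    (h : α ∈ spectrum ℂ (t • C)) : α / t ∈ spectrum ℂ C := by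
  rw [spectrum.mem_iff] at h ⊢
  refine fun hu => h ?_
  have h1 : algebraMap ℂ (Matrix (Fin n) (Fin n) ℂ) α - t • C =
      t • (algebraMap ℂ (Matrix (Fin n) (Fin n) ℂ) (α / t) - C) := by
    rw [smul_sub, Algebra.algebraMap_eq_smul_one, Algebra.algebraMap_eq_smul_one, smul_smul,
      mul_div_cancel₀ _ ht]
  rw [h1]
  exact hu.smul (Units.mk0 t ht)

/-- The linear operator `X ↦ C₁⁻¹ X C₂` as a matrix acting on vectorized matrices. -/
noncomputable def conjMatrix (C₁ : Matrix (Fin m₁) (Fin m₁) ℂ) (C₂ : Matrix (Fin m₂) (Fin m₂) ℂ) :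
    Matrix (Fin m₂ × Fin m₁) (Fin m₂ × Fin m₁) ℂ := C₂ᵀ ⊗ₖ C₁⁻¹

theorem conjMatrix_mulVec_vec (X : Matrix (Fin m₁) (Fin m₂) ℂ) :
    conjMatrix C₁ C₂ *ᵥ X.vec = (C₁⁻¹ * X * C₂).vec := by
  rw [conjMatrix, Matrix.kronecker_mulVec_vec, Matrix.transpose_transpose]

theorem isUnit_conjMatrix (hC₁ : IsUnit C₁) (hC₂ : IsUnit C₂) : IsUnit (conjMatrix C₁ C₂) := by
  rw [Matrix.isUnit_iff_isUnit_det] at hC₁ hC₂ ⊢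
  rw [conjMatrix, Matrix.det_kronecker, Matrix.det_transpose]
  exact (hC₂.pow _).mul ((Matrix.isUnit_nonsing_inv_det _ hC₁).pow _)

variable {q τ : ℂ} {N : ℕ}

/-- A kernel vector, read as a matrix `M`, satisfies `M (t C₂) = C₁ M`; a common eigenvalue of `C₁`
and `t C₂` would put `lam` in `Σ`. -/
theorem resolventDen_conjMatrix_ne_zero (hτ : Complex.exp τ = q) (hN : N ≠ 0) (hC₁ : IsUnit C₁)
    {lam : ℂˣ}
    (hlam : (QuotientGroup.mk lam : ℂˣ ⧸ spiralGroup τ N) ∉ exceptionalSet q τ N C₁ C₂) (l : ℤ) :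
    resolventDen N (qpow τ (1 / N) ^ (-tri (N - 1)) • conjMatrix C₁ C₂)
      (qpow τ (1 / N) ^ l * lam) ≠ 0 := by
  intro h0
  have hdet₁ := (Matrix.isUnit_iff_isUnit_det C₁).mp hC₁
  set p := qpow τ (1 / N) with hp
  have hp0 : p ≠ 0 := qpow_ne_zero _ _
  have hq0 : q ≠ 0 := by
    rw [← hτ]
    exact Complex.exp_ne_zero τ
  rw [resolventDen, smul_smul] at h0
  set t := (p ^ l * (lam : ℂ)) ^ N * p ^ (-tri (N - 1)) with ht
  have ht0 : t ≠ 0 := mul_ne_zero (pow_ne_zero _ (mul_ne_zero (zpow_ne_zero _ hp0) lam.ne_zero))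
    (zpow_ne_zero _ hp0)
  obtain ⟨v, hv0, hv⟩ := Matrix.exists_mulVec_eq_zero_iff.mpr h0
  obtain ⟨M, rfl⟩ : ∃ M : Matrix (Fin m₁) (Fin m₂) ℂ, M.vec = v :=
    ⟨Matrix.of fun i j => v (j, i), rfl⟩
  rw [Matrix.sub_mulVec, Matrix.one_mulVec, Matrix.smul_mulVec, conjMatrix_mulVec_vec,
    sub_eq_zero, ← Matrix.vec_smul, Matrix.vec_inj] at hv
  have hM0 : M ≠ 0 := by
    rintro rfl
    exact hv0 Matrix.vec_zero
  have h1 : M * (t • C₂) = C₁ * M := by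
    conv_rhs => rw [hv]
    rw [Matrix.mul_smul, Matrix.mul_smul, Matrix.mul_assoc C₁⁻¹, Matrix.mul_nonsing_inv_cancel_left _ _ hdet₁]
  obtain ⟨α, hα₁, hα₂⟩ := exists_mem_spectrum_of_intertwining hM0 h1
  have hα0 : α ≠ 0 := by
    rintro rfl
    exact (spectrum.zero_mem_iff ℂ).mp hα₁ hC₁
  -- The quotient of the two eigenvalues is `t = q^l lam^N κ`, whence the exponent `-l`.
  refine hlam ⟨lam, rfl, α, hα₁, α / t, mem_spectrum_smul ht0 hα₂, -l, ?_⟩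
  rw [qpow_neg_half hN, ← hp, div_div_cancel₀ hα0, ht, mul_pow, zpow_neg q, ← zpow_natCast (p ^ l),
    ← zpow_mul, mul_comm l, zpow_mul, zpow_natCast, hp, qpow_one_div_pow hτ hN]
  have : q ^ l ≠ 0 := zpow_ne_zero _ hq0
  field_simp

/-- Replacing `lam` by `lam p^(-k)` divides `lam^N` by `q^k`. So each class has a representative
with `lam^N κ = α₁ / α₂` exactly, and these are roots of finitely many numbers. -/
theorem finite_exceptionalSet (hτ : Complex.exp τ = q) (hN : N ≠ 0)
    (C₁ : Matrix (Fin m₁) (Fin m₁) ℂ) (C₂ : Matrix (Fin m₂) (Fin m₂) ℂ) :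
    (exceptionalSet q τ N C₁ C₂).Finite := by
  have hq0 : q ≠ 0 := by
    rw [← hτ]
    exact Complex.exp_ne_zero τ
  set κ := qpow τ (-((N : ℂ) - 1) / 2) with hκ
  have hκ0 : κ ≠ 0 := qpow_ne_zero _ _
  have h1 : (Set.image2 (fun α₁ α₂ => α₁ / α₂ / κ) (spectrum ℂ C₁) (spectrum ℂ C₂)).Finite :=
    (Matrix.finite_spectrum C₁).image2 _ (Matrix.finite_spectrum C₂)
  have h2 : {lam : ℂˣ | (lam : ℂ) ^ N ∈
      Set.image2 (fun α₁ α₂ => α₁ / α₂ / κ) (spectrum ℂ C₁) (spectrum ℂ C₂)}.Finite :=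
    Set.Finite.preimage (f := (Units.val : ℂˣ → ℂ)) Units.val_injective.injOn
      (finite_setOf_pow_mem hN h1)
  refine (h2.image (QuotientGroup.mk : ℂˣ → ℂˣ ⧸ spiralGroup τ N)).subset ?_
  rintro _ ⟨lam, rfl, α₁, hα₁, α₂, hα₂, k, hk⟩
  set u : ℂˣ := Units.mk0 (qpow τ (1 / (N : ℂ))) (qpow_ne_zero _ _)
  have hu : (u : ℂ) = qpow τ (1 / N) := rfl
  refine ⟨lam * u ^ (-k), ⟨α₁, hα₁, α₂, hα₂, ?_⟩, ?_⟩
  · have h3 : ((lam * u ^ (-k) : ℂˣ) : ℂ) ^ N = (lam : ℂ) ^ N * (q ^ k)⁻¹ := by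
      rw [Units.val_mul, Units.val_zpow_eq_zpow_val, hu, mul_pow, zpow_neg, inv_pow,
        ← zpow_natCast (_ ^ k), ← zpow_mul, mul_comm k, zpow_mul, zpow_natCast,
        qpow_one_div_pow hτ hN]
    have h4 : q ^ k ≠ 0 := zpow_ne_zero _ hq0
    change α₁ / α₂ / κ = _
    rw [h3, div_eq_iff hκ0, mul_right_comm, hk, mul_assoc, mul_inv_cancel₀ h4, mul_one]
  · rw [QuotientGroup.eq]
    refine Subgroup.mem_zpowers_iff.mpr ⟨k, ?_⟩
    change u ^ k = _
    group

end Spectrum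

/-! ### The gauge equations -/

section Gauge

variable {q : ℂ} {m₁ m₂ : ℕ} {n₁ n₂ : ℤ} {N : ℕ} {C₁ : Matrix (Fin m₁) (Fin m₁) ℂ}
  {C₂ : Matrix (Fin m₂) (Fin m₂) ℂ} {U : ℤ → Matrix (Fin m₁) (Fin m₂) ℂ}

theorem sum_Ico_eq_sum_range {M : Type*} [AddCommMonoid M] (hN : (N : ℤ) = n₂ - n₁) (f : ℤ → M) :
    ∑ ν ∈ Finset.Ico n₁ n₂, f ν = ∑ l ∈ Finset.range N, f (n₁ + l) := by
  refine (Finset.sum_nbij' (fun l : ℕ => n₁ + l) (fun ν => (ν - n₁).toNat) ?_ ?_ ?_ ?_ ?_).symm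
  · intro l hl
    have := Finset.mem_range.mp hl
    exact Finset.mem_Ico.mpr (by omega)
  · intro ν hν
    have := Finset.mem_Ico.mp hν
    exact Finset.mem_range.mpr (by omega)
  · intro l _
    simp
  · intro ν hν
    have := Finset.mem_Ico.mp hν
    omega
  · exact fun _ _ => rfl

theorem formalGauge_blocks {X : Matrix (Fin m₁) (Fin m₂) (PowerSeries ℂ)} :
    IsFormalGauge q n₁ n₂ C₁ C₂ U X ↔
      (C₁.map fun c => HahnSeries.single n₁ c) * X.map (HahnSeries.ofPowerSeries ℤ ℂ) +
          ∑ ν ∈ Finset.Ico n₁ n₂, (U ν).map (fun c => HahnSeries.single ν c) =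
        (X.map (PowerSeries.rescale q)).map (HahnSeries.ofPowerSeries ℤ ℂ) *
          C₂.map fun c => HahnSeries.single n₂ c := by
  have h0 : ∑ ν ∈ Finset.Ico n₁ n₂, ((0 : ℤ → Matrix (Fin m₁) (Fin m₂) ℂ) ν).map
      (fun c => (HahnSeries.single ν c : LaurentSeries ℂ)) = 0 :=
    Finset.sum_eq_zero fun ν _ => by
      ext i j
      simp
  rw [IsFormalGauge, formalBG, formalBG, h0, unip]
  simp only [Matrix.fromBlocks_map, Matrix.fromBlocks_multiply, Matrix.map_zero _ (map_zero _),
    Matrix.map_one _ (map_zero _) (map_one _), Matrix.mul_zero, Matrix.zero_mul, Matrix.mul_one,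
    Matrix.one_mul, add_zero, zero_add, Matrix.fromBlocks_inj, true_and, and_true]

/-- Compare the coefficients of `z^(n₁ + l)`. The right side starts at `z^(n₁ + N)`, and below
`z^n₁` both sides vanish. -/
theorem isFormalGauge_iff (hN : (N : ℤ) = n₂ - n₁) {X : Matrix (Fin m₁) (Fin m₂) (PowerSeries ℂ)} :
    IsFormalGauge q n₁ n₂ C₁ C₂ U X ↔ ∀ l : ℕ,
      C₁ * X.map (PowerSeries.coeff l) + (if l < N then U (n₁ + l) else 0) =
        if l < N then 0 else q ^ (l - N) • (X.map (PowerSeries.coeff (l - N)) * C₂) := by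
  rw [formalGauge_blocks]
  have hneg (F : PowerSeries ℂ) {m : ℤ} (hm : m < 0) :
      (HahnSeries.ofPowerSeries ℤ ℂ F).coeff m = 0 := by
    rw [PowerSeries.coeff_coe, if_pos hm]
  have hpos (F : PowerSeries ℂ) (l : ℕ) :
      (HahnSeries.ofPowerSeries ℤ ℂ F).coeff (l : ℤ) = PowerSeries.coeff l F :=
    HahnSeries.ofPowerSeries_apply_coeff F l
  have hL (m : ℤ) (i : Fin m₁) (j : Fin m₂) :
      (((C₁.map fun c => HahnSeries.single n₁ c) * X.map (HahnSeries.ofPowerSeries ℤ ℂ) +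
          ∑ ν ∈ Finset.Ico n₁ n₂, (U ν).map (fun c => (HahnSeries.single ν c : LaurentSeries ℂ)))
          i j).coeff (n₁ + m) =
        ∑ k, C₁ i k * (HahnSeries.ofPowerSeries ℤ ℂ (X k j)).coeff m +
          if 0 ≤ m ∧ m < N then U (n₁ + m) i j else 0 := by
    rw [Matrix.add_apply, Matrix.mul_apply, Matrix.sum_apply, HahnSeries.coeff_add,
      HahnSeries.coeff_sum, HahnSeries.coeff_sum]
    congr 1
    · refine Finset.sum_congr rfl fun k _ => ?_
      rw [Matrix.map_apply, Matrix.map_apply, HahnSeries.coeff_single_mul, add_sub_cancel_left]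
    · simp only [Matrix.map_apply, HahnSeries.coeff_single]
      have hiff : n₁ + m ∈ Finset.Ico n₁ n₂ ↔ 0 ≤ m ∧ m < N := by
        rw [Finset.mem_Ico]
        omega
      simp only [← hiff]
      convert Finset.sum_ite_eq (Finset.Ico n₁ n₂) (n₁ + m) fun ν => U ν i j
  have hR (m : ℤ) (i : Fin m₁) (j : Fin m₂) :
      (((X.map (PowerSeries.rescale q)).map (HahnSeries.ofPowerSeries ℤ ℂ) *
          C₂.map (fun c => (HahnSeries.single n₂ c : LaurentSeries ℂ))) i j).coeff (n₁ + m) =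
        ∑ k, (HahnSeries.ofPowerSeries ℤ ℂ (PowerSeries.rescale q (X i k))).coeff (m - N) *
          C₂ k j := by
    rw [Matrix.mul_apply, HahnSeries.coeff_sum]
    refine Finset.sum_congr rfl fun k _ => ?_
    rw [Matrix.map_apply, Matrix.map_apply, Matrix.map_apply, HahnSeries.coeff_mul_single, hN]
    congr 2
    ring
  have hnat (l : ℕ) (i : Fin m₁) (j : Fin m₂) :
      (∑ k, C₁ i k * (HahnSeries.ofPowerSeries ℤ ℂ (X k j)).coeff (l : ℤ) +
        (if 0 ≤ (l : ℤ) ∧ (l : ℤ) < N then U (n₁ + l) i j else 0) =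
        ∑ k, (HahnSeries.ofPowerSeries ℤ ℂ (PowerSeries.rescale q (X i k))).coeff ((l : ℤ) - N) *
          C₂ k j) ↔
      (C₁ * X.map (PowerSeries.coeff l) + (if l < N then U (n₁ + l) else 0)) i j =
        (if l < N then 0 else q ^ (l - N) • (X.map (PowerSeries.coeff (l - N)) * C₂)) i j := by
    rcases lt_or_ge l N with h | h
    · have h1 : (l : ℤ) - N < 0 := by omega
      have h2 : 0 ≤ (l : ℤ) ∧ (l : ℤ) < N := by omega
      simp only [hneg _ h1, hpos, if_pos h, if_pos h2, Matrix.add_apply, Matrix.mul_apply,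
        Matrix.map_apply, zero_mul, Finset.sum_const_zero, Matrix.zero_apply]
    · have h1 : (l : ℤ) - N = ((l - N : ℕ) : ℤ) := by omega
      have h2 : ¬ (0 ≤ (l : ℤ) ∧ (l : ℤ) < N) := by omega
      simp only [h1, hpos, if_neg h.not_gt, if_neg h2, Matrix.mul_apply, Matrix.map_apply,
        add_zero, Matrix.smul_apply, PowerSeries.coeff_rescale, smul_eq_mul, Finset.mul_sum,
        mul_assoc]
  constructor
  · intro h l
    ext i j
    rw [← hnat, ← hL, ← hR, h]
  · intro h
    ext i j n
    obtain ⟨m, rfl⟩ : ∃ m, n = n₁ + m := ⟨n - n₁, by ring⟩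
    rw [hL, hR]
    rcases lt_or_ge m 0 with hm | hm
    · have h1 : m - N < 0 := by omega
      have h2 : ¬ (0 ≤ m ∧ m < N) := by omega
      simp only [hneg _ hm, hneg _ h1, if_neg h2, mul_zero, zero_mul, Finset.sum_const_zero,
        add_zero]
    · lift m to ℕ using hm
      rw [hnat, h]

theorem evalBG_mul_unip_iff (hN : (N : ℤ) = n₂ - n₁) (hC₁ : IsUnit C₁) {z : ℂ} (hz : z ≠ 0)
    {X Y : Matrix (Fin m₁) (Fin m₂) ℂ} :
    evalBG n₁ n₂ C₁ C₂ U z * unip X = unip Y * evalBG n₁ n₂ C₁ C₂ 0 z ↔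
      X = ∑ l ∈ Finset.range N, z ^ l • -(C₁⁻¹ * U (n₁ + l)) + z ^ N • (C₁⁻¹ * Y * C₂) := by
  have hdet := (Matrix.isUnit_iff_isUnit_det C₁).mp hC₁
  have hz₁ : z ^ n₁ ≠ 0 := zpow_ne_zero _ hz
  have hn₂ : z ^ n₂ = z ^ n₁ * z ^ N := by
    rw [← zpow_natCast, hN, ← zpow_add₀ hz, add_sub_cancel]
  have h1 : evalBG n₁ n₂ C₁ C₂ U z * unip X = unip Y * evalBG n₁ n₂ C₁ C₂ 0 z ↔
      (z ^ n₁ • C₁) * X + ∑ ν ∈ Finset.Ico n₁ n₂, z ^ ν • U ν = Y * (z ^ n₂ • C₂) := by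
    simp only [evalBG, unip, Matrix.fromBlocks_multiply, Matrix.mul_zero, Matrix.zero_mul,
      Matrix.mul_one, Matrix.one_mul, add_zero, zero_add, Matrix.fromBlocks_inj, true_and, and_true,
      Pi.zero_apply, smul_zero, Finset.sum_const_zero]
  have h2 : (z ^ n₁ • C₁) * (∑ l ∈ Finset.range N, z ^ l • -(C₁⁻¹ * U (n₁ + l)) +
      z ^ N • (C₁⁻¹ * Y * C₂)) + ∑ ν ∈ Finset.Ico n₁ n₂, z ^ ν • U ν = Y * (z ^ n₂ • C₂) := by
    rw [sum_Ico_eq_sum_range hN, Matrix.mul_add, Matrix.mul_sum, add_right_comm,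
      ← Finset.sum_add_distrib, Finset.sum_eq_zero, zero_add, hn₂]
    · rw [Matrix.smul_mul, Matrix.mul_smul, Matrix.mul_smul, Matrix.mul_assoc C₁⁻¹,
        Matrix.mul_nonsing_inv_cancel_left _ _ hdet, smul_smul]
    · intro l _
      rw [Matrix.smul_mul, Matrix.mul_smul, Matrix.mul_neg,
        Matrix.mul_nonsing_inv_cancel_left _ _ hdet, zpow_add₀ hz, zpow_natCast, smul_neg, smul_neg,
        smul_smul, neg_add_cancel]
  rw [h1]
  constructor
  · intro h
    rw [← h2, add_left_inj, Matrix.smul_mul, Matrix.smul_mul] at h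
    have h3 := congrArg (fun M => C₁⁻¹ * M) (smul_right_injective _ hz₁ h)
    simpa only [Matrix.nonsing_inv_mul_cancel_left _ _ hdet] using h3
  · rintro rfl
    exact h2

end Gauge

/-! ### The formal gauge transformation -/

section Formal

variable {q τ : ℂ} {m₁ m₂ : ℕ} {n₁ n₂ : ℤ} {N : ℕ} {C₁ : Matrix (Fin m₁) (Fin m₁) ℂ}
  {C₂ : Matrix (Fin m₂) (Fin m₂) ℂ} {U : ℤ → Matrix (Fin m₁) (Fin m₂) ℂ}

/-- The coefficients of the formal gauge transformation. -/
noncomputable def gaugeCoeff (q : ℂ) (N : ℕ) (n₁ : ℤ) (C₁ : Matrix (Fin m₁) (Fin m₁) ℂ)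
    (C₂ : Matrix (Fin m₂) (Fin m₂) ℂ) (U : ℤ → Matrix (Fin m₁) (Fin m₂) ℂ) (l : ℕ) :
    Matrix (Fin m₁) (Fin m₂) ℂ :=
  -- The condition `N ≠ 0` makes the recursion terminate.
  if _h : N ≠ 0 ∧ N ≤ l then q ^ (l - N) • (C₁⁻¹ * gaugeCoeff q N n₁ C₁ C₂ U (l - N) * C₂)
  else -(C₁⁻¹ * U (n₁ + l))
termination_by l
decreasing_by omega

theorem gaugeCoeff_of_lt {l : ℕ} (h : l < N) :
    gaugeCoeff q N n₁ C₁ C₂ U l = -(C₁⁻¹ * U (n₁ + l)) := by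
  rw [gaugeCoeff, dif_neg (by omega)]

theorem gaugeCoeff_add (hN : N ≠ 0) (l : ℕ) :
    gaugeCoeff q N n₁ C₁ C₂ U (l + N) = q ^ l • (C₁⁻¹ * gaugeCoeff q N n₁ C₁ C₂ U l * C₂) := by
  rw [gaugeCoeff, dif_pos (by omega), Nat.add_sub_cancel]

/-- The upper right block of the formal gauge transformation. -/
noncomputable def formalGauge (q : ℂ) (N : ℕ) (n₁ : ℤ) (C₁ : Matrix (Fin m₁) (Fin m₁) ℂ)
    (C₂ : Matrix (Fin m₂) (Fin m₂) ℂ) (U : ℤ → Matrix (Fin m₁) (Fin m₂) ℂ) :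
    Matrix (Fin m₁) (Fin m₂) (PowerSeries ℂ) :=
  Matrix.of fun i j => PowerSeries.mk fun l => gaugeCoeff q N n₁ C₁ C₂ U l i j

theorem formalGauge_map_coeff (l : ℕ) :
    (formalGauge q N n₁ C₁ C₂ U).map (PowerSeries.coeff l) = gaugeCoeff q N n₁ C₁ C₂ U l := by
  ext i j
  simp [formalGauge]

/-- Since `C₁` is invertible, the equation determines each coefficient from the one `N` places
earlier; existence and uniqueness come together. -/
theorem isFormalGauge_iff_eq (hN0 : N ≠ 0) (hN : (N : ℤ) = n₂ - n₁) (hC₁ : IsUnit C₁)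
    {X : Matrix (Fin m₁) (Fin m₂) (PowerSeries ℂ)} :
    IsFormalGauge q n₁ n₂ C₁ C₂ U X ↔ X = formalGauge q N n₁ C₁ C₂ U := by
  have hdet := (Matrix.isUnit_iff_isUnit_det C₁).mp hC₁
  have hsolve {A B : Matrix (Fin m₁) (Fin m₂) ℂ} : C₁ * A = B ↔ A = C₁⁻¹ * B := by
    constructor
    · rintro rfl
      rw [Matrix.nonsing_inv_mul_cancel_left _ _ hdet]
    · rintro rfl
      rw [Matrix.mul_nonsing_inv_cancel_left _ _ hdet]
  have hiff (X : Matrix (Fin m₁) (Fin m₂) (PowerSeries ℂ)) (l : ℕ) :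
      (C₁ * X.map (PowerSeries.coeff l) + (if l < N then U (n₁ + l) else 0) =
        if l < N then 0 else q ^ (l - N) • (X.map (PowerSeries.coeff (l - N)) * C₂)) ↔
      X.map (PowerSeries.coeff l) = if l < N then -(C₁⁻¹ * U (n₁ + l)) else
        q ^ (l - N) • (C₁⁻¹ * X.map (PowerSeries.coeff (l - N)) * C₂) := by
    rcases lt_or_ge l N with h | h
    · rw [if_pos h, if_pos h, if_pos h, add_eq_zero_iff_eq_neg, hsolve, Matrix.mul_neg]
    · rw [if_neg h.not_gt, if_neg h.not_gt, if_neg h.not_gt, add_zero, hsolve, Matrix.mul_smul,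
        Matrix.mul_assoc]
  rw [isFormalGauge_iff hN]
  simp only [hiff]
  constructor
  · intro h
    have h1 (l : ℕ) : X.map (PowerSeries.coeff l) = gaugeCoeff q N n₁ C₁ C₂ U l := by
      induction l using Nat.strong_induction_on with
      | _ l ih =>
        rw [h l]
        rcases lt_or_ge l N with hl | hl
        · rw [if_pos hl, gaugeCoeff_of_lt hl]
        · obtain ⟨k, rfl⟩ := Nat.exists_eq_add_of_le' hl
          rw [if_neg hl.not_gt, gaugeCoeff_add hN0, Nat.add_sub_cancel, ih k (by omega)]
    ext i j l
    have h2 := congrFun (congrFun ((h1 l).trans (formalGauge_map_coeff l).symm) i) j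
    exact h2
  · rintro rfl l
    simp only [formalGauge_map_coeff]
    rcases lt_or_ge l N with hl | hl
    · rw [if_pos hl, gaugeCoeff_of_lt hl]
    · obtain ⟨k, rfl⟩ := Nat.exists_eq_add_of_le' hl
      rw [if_neg hl.not_gt, gaugeCoeff_add hN0, Nat.add_sub_cancel]

/-- The coefficients of the Borel transform satisfy a recursion with constant coefficients. -/
theorem borel_gaugeCoeff_add (hτ : Complex.exp τ = q) (hN : N ≠ 0) (l : ℕ) :
    qpow τ (1 / N) ^ (-tri ((l + N : ℕ) - 1)) • (gaugeCoeff q N n₁ C₁ C₂ U (l + N)).vec =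
      (qpow τ (1 / N) ^ (-tri (N - 1)) • conjMatrix C₁ C₂) *ᵥ
        (qpow τ (1 / N) ^ (-tri (l - 1)) • (gaugeCoeff q N n₁ C₁ C₂ U l).vec) := by
  have hp0 : qpow τ (1 / N) ≠ 0 := qpow_ne_zero _ _
  rw [gaugeCoeff_add hN, Matrix.vec_smul, smul_smul, Matrix.smul_mulVec, Matrix.mulVec_smul,
    smul_smul, conjMatrix_mulVec_vec]
  congr 1
  rw [← qpow_one_div_pow hτ hN, ← pow_mul, ← zpow_natCast, ← zpow_add₀ hp0, ← zpow_add₀ hp0]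
  congr 1
  -- The exponent identity is `(l+N)(l+N-1)/2 = l(l-1)/2 + N(N-1)/2 + N l`, with `q^l = p^(N l)`.
  have h1 := two_mul_tri ((l + N : ℕ) - 1)
  have h2 := two_mul_tri (l - 1)
  have h3 := two_mul_tri (N - 1)
  push_cast at h1 ⊢
  linarith

theorem coeff_qBorel_formalGauge (hN : N ≠ 0) (i : Fin m₁) (j : Fin m₂) (l : ℕ) :
    PowerSeries.coeff l (qBorel τ N (formalGauge q N n₁ C₁ C₂ U i j)) =
      (qpow τ (1 / N) ^ (-tri (l - 1)) • (gaugeCoeff q N n₁ C₁ C₂ U l).vec) (j, i) := by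
  rw [qBorel, PowerSeries.coeff_mk, Rat.cast_natCast, qpow_neg_triangular hN, formalGauge,
    Matrix.of_apply, PowerSeries.coeff_mk, Pi.smul_apply, smul_eq_mul, mul_comm]
  rfl

end Formal

/-! ### Constants -/

section Constants

variable {q τ : ℂ} {N : ℕ}

/-- Summation acts on every entry of the unipotent matrix; this covers the constant entries `0` and
`1`. -/
theorem isSpiralQuotient_const (p lam c : ℂ) :
    IsSpiralQuotient p lam (fun _ => c) (fun _ => 1) where
  differentiable_num := differentiable_const c
  differentiable_den := differentiable_const 1
  finite_zeros := by simp
  den_zero := one_ne_zero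
  den_spiral := fun _ => one_ne_zero
  bounded := ⟨0, ‖c‖, fun _ _ => by rw [div_one]⟩

theorem isSumNearZero_qBorel_C (c : ℂ) :
    IsSumNearZero (qBorel τ N (PowerSeries.C c)) fun _ => c / 1 := by
  refine ⟨1, one_pos, fun z _ => ?_⟩
  have h : (fun k : ℕ => PowerSeries.coeff k (qBorel τ N (PowerSeries.C c)) * z ^ k) =
      fun k => if k = 0 then c else 0 := by
    funext k
    rw [qBorel, PowerSeries.coeff_mk, PowerSeries.coeff_C]
    split_ifs with hk
    · subst hk
      simp [qpow]
    · simp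
  rw [h, div_one]
  exact hasSum_ite_eq 0 c

theorem laplaceQuotient_const {p lam z : ℂ} (c : ℂ) (hθ : theta p (z / lam) ≠ 0) :
    laplaceQuotient p lam (fun _ => c / 1) z = c := by
  have h : thetaSeries (fun _ => c / 1) p (z / lam) = c * theta p (z / lam) := by
    rw [theta_eq_thetaSeries, thetaSeries, thetaSeries, ← tsum_mul_left]
    exact tsum_congr fun l => by rw [div_one, one_mul]
  rw [laplaceQuotient, h, mul_div_cancel_right₀ _ hθ]

theorem isBorelLaplaceSum_C (hq : 1 < ‖q‖) (hτ : Complex.exp τ = q) (hN : N ≠ 0) {lam : ℂ}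
    (hlam : lam ≠ 0) (c : ℂ) :
    (∃ s, IsBorelLaplaceSum q τ N N lam (PowerSeries.C c) s) ∧
      ∀ s, IsBorelLaplaceSum q τ N N lam (PowerSeries.C c) s →
        ∀ w, w ≠ 0 → ∀ᶠ z in 𝓝[≠] w, s z = c := by
  have hQ := isSpiralQuotient_const (qpow τ (1 / N)) lam c
  refine ⟨⟨_, hQ.isBorelLaplaceSum hq hτ hN hlam (isSumNearZero_qBorel_C c)⟩, fun s hs w hw => ?_⟩
  filter_upwards [hQ.eventuallyEq_of_isBorelLaplaceSum hq hτ hN hlam (isSumNearZero_qBorel_C c) hs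
    hw, eventually_theta_div_ne_zero (one_lt_norm_qpow hq hτ hN) hlam hw] with z h1 h2
  rw [h1, laplaceQuotient_const c h2]

end Constants

/-! ### The meromorphic gauge transformation -/

section Meromorphic

variable {q τ : ℂ} {m₁ m₂ : ℕ} {n₁ n₂ : ℤ} {N : ℕ} {C₁ : Matrix (Fin m₁) (Fin m₁) ℂ}
  {C₂ : Matrix (Fin m₂) (Fin m₂) ℂ} {U : ℤ → Matrix (Fin m₁) (Fin m₂) ℂ} {lam : ℂ}

/-- Here `q` is arbitrary: the first `N` coefficients of the formal solution do not depend on it. -/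
theorem evalBG_mul_unip_iff_vec (hN : (N : ℤ) = n₂ - n₁) (hC₁ : IsUnit C₁) {z : ℂ} (hz : z ≠ 0)
    {X Y : Matrix (Fin m₁) (Fin m₂) ℂ} :
    evalBG n₁ n₂ C₁ C₂ U z * unip X = unip Y * evalBG n₁ n₂ C₁ C₂ 0 z ↔
      X.vec = ∑ l ∈ Finset.range N, z ^ l • (gaugeCoeff q N n₁ C₁ C₂ U l).vec +
        z ^ N • conjMatrix C₁ C₂ *ᵥ Y.vec := by
  rw [evalBG_mul_unip_iff hN hC₁ hz, conjMatrix_mulVec_vec, ← Matrix.vec_inj, Matrix.vec_add,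
    Matrix.vec_sum, Matrix.vec_smul]
  have h : ∑ l ∈ Finset.range N, (z ^ l • -(C₁⁻¹ * U (n₁ + l))).vec =
      ∑ l ∈ Finset.range N, z ^ l • (gaugeCoeff q N n₁ C₁ C₂ U l).vec :=
    Finset.sum_congr rfl fun l hl => by
      rw [gaugeCoeff_of_lt (Finset.mem_range.mp hl), Matrix.vec_smul]
  rw [h]

/-- The Borel-Laplace sum of the formal gauge transformation. -/
noncomputable def summedGauge (q τ : ℂ) (N : ℕ) (n₁ : ℤ) (C₁ : Matrix (Fin m₁) (Fin m₁) ℂ)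
    (C₂ : Matrix (Fin m₂) (Fin m₂) ℂ) (U : ℤ → Matrix (Fin m₁) (Fin m₂) ℂ) (lam z : ℂ) :
    Matrix (Fin m₁) (Fin m₂) ℂ :=
  Matrix.of fun i j => laplaceResolvent (qpow τ (1 / N)) lam N
    (qpow τ (1 / N) ^ (-tri (N - 1)) • conjMatrix C₁ C₂)
    (fun l => qpow τ (1 / N) ^ (-tri (l - 1)) • (gaugeCoeff q N n₁ C₁ C₂ U l).vec) z (j, i)

theorem isUnit_smul_conjMatrix (hC₁ : IsUnit C₁) (hC₂ : IsUnit C₂) {c : ℂ} (hc : c ≠ 0) :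
    IsUnit (c • conjMatrix C₁ C₂) :=
  (isUnit_conjMatrix hC₁ hC₂).smul (Units.mk0 c hc)

theorem isMeromorphicGauge_summedGauge (hq : 1 < ‖q‖) (hτ : Complex.exp τ = q) (hN0 : N ≠ 0)
    (hN : (N : ℤ) = n₂ - n₁) (hC₁ : IsUnit C₁) (hC₂ : IsUnit C₂) (hlam : lam ≠ 0)
    (hsp : ∀ l : ℤ, resolventDen N (qpow τ (1 / N) ^ (-tri (N - 1)) • conjMatrix C₁ C₂)
      (qpow τ (1 / N) ^ l * lam) ≠ 0) :
    IsMeromorphicGauge q τ n₁ n₂ C₁ C₂ U N lam (summedGauge q τ N n₁ C₁ C₂ U lam) := by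
  have hp := one_lt_norm_qpow hq hτ hN0
  have hQ (i : Fin m₁) (j : Fin m₂) := isSpiralQuotient_resolvent hN0
    (isUnit_smul_conjMatrix hC₁ hC₂ (zpow_ne_zero (-tri (N - 1)) (qpow_ne_zero τ (1 / N))))
    (fun l => qpow τ (1 / N) ^ (-tri (l - 1)) • (gaugeCoeff q N n₁ C₁ C₂ U l).vec) hsp (j, i)
  refine ⟨fun i j => (hQ i j).meromorphicOn_laplaceQuotient hp hlam, fun w hw => ?_,
    -- The pole conditions hold on all of `ℂ*`, so the radius is arbitrary.
    1, one_pos, fun w hw _ i j => ?_⟩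
  · filter_upwards [eventually_theta_div_ne_zero hp hlam hw,
      nhdsWithin_le_nhds (isOpen_ne.mem_nhds hw)] with z hθ hz
    rw [evalBG_mul_unip_iff_vec (q := q) hN hC₁ hz]
    have := laplaceResolvent_eq hp hN0 (isUnit_conjMatrix hC₁ hC₂) hlam
      (fun l => (gaugeCoeff q N n₁ C₁ C₂ U l).vec) hsp hz hθ
    rw [qpow_one_div_pow hτ hN0] at this
    exact this
  · simp only [spiralPoint_eq]
    exact (hQ i j).meromorphicOrderAt_laplaceQuotient hp hlam (norm_pos_iff.mp hw)

/-- The inhomogeneous terms cancel in the difference, and the pole conditions survive subtraction.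
-/
theorem meroEq_of_isMeromorphicGauge (hq : 1 < ‖q‖) (hτ : Complex.exp τ = q) (hN0 : N ≠ 0)
    (hN : (N : ℤ) = n₂ - n₁) (hC₁ : IsUnit C₁) (hlam : lam ≠ 0)
    (hsp : ∀ l : ℤ, resolventDen N (qpow τ (1 / N) ^ (-tri (N - 1)) • conjMatrix C₁ C₂)
      (qpow τ (1 / N) ^ l * lam) ≠ 0) {X Y : ℂ → Matrix (Fin m₁) (Fin m₂) ℂ}
    (hX : IsMeromorphicGauge q τ n₁ n₂ C₁ C₂ U N lam X)
    (hY : IsMeromorphicGauge q τ n₁ n₂ C₁ C₂ U N lam Y) : MeroEq X Y := by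
  have hp := one_lt_norm_qpow hq hτ hN0
  intro w hw
  have hz : ∀ a : Fin m₂ × Fin m₁, ∀ᶠ z in 𝓝[≠] w, (X z - Y z).vec a = 0 := by
    intro a
    refine eventually_eq_zero_of_homogeneous (Φ := conjMatrix C₁ C₂) hp hN0 hlam hsp
      (Y := fun z => (X z - Y z).vec)
      (fun a => (hX.meromorphic a.2 a.1).sub (hY.meromorphic a.2 a.1)) (fun w hw => ?_) ?_ hw a
    · filter_upwards [hX.equation w hw, hY.equation w hw,
        nhdsWithin_le_nhds (isOpen_ne.mem_nhds hw)] with z h1 h2 hz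
      rw [evalBG_mul_unip_iff_vec (q := q) hN hC₁ hz] at h1 h2
      rw [qpow_one_div_pow hτ hN0, Matrix.vec_sub, Matrix.vec_sub, h1, h2, Matrix.mulVec_sub,
        smul_sub, add_sub_add_left_eq_sub]
    · obtain ⟨r₁, hr₁, h1⟩ := hX.poles
      obtain ⟨r₂, hr₂, h2⟩ := hY.poles
      refine ⟨min r₁ r₂, lt_min hr₁ hr₂, fun u hu hur a => ?_⟩
      have hu0 : u ≠ 0 := norm_pos_iff.mp hu
      have h3 := h1 u hu (hur.trans_le (min_le_left _ _)) a.2 a.1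
      have h4 := h2 u hu (hur.trans_le (min_le_right _ _)) a.2 a.1
      simp only [spiralPoint_eq] at h3 h4
      have h5 : min (meromorphicOrderAt (fun z => X z a.2 a.1) u)
          (meromorphicOrderAt (fun z => Y z a.2 a.1) u) ≤
          meromorphicOrderAt (fun z => (X z - Y z).vec a) u := by
        have h6 := meromorphicOrderAt_add (hX.meromorphic a.2 a.1 u hu0)
          (hY.meromorphic a.2 a.1 u hu0).neg
        rw [← meromorphicOrderAt_neg (f := fun z => Y z a.2 a.1), ← sub_eq_add_neg] at h6
        exact h6
      exact ⟨(le_min h3.1 h4.1).trans h5, fun h => (le_min (h3.2 h) (h4.2 h)).trans h5⟩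
  filter_upwards [eventually_all.mpr hz] with z h
  ext i j
  exact sub_eq_zero.mp (h (j, i))

/-- Every entry of the unipotent formal gauge transformation has a Borel-Laplace sum, which is
unique as a meromorphic function. -/
theorem isBorelLaplaceSum_unip (hq : 1 < ‖q‖) (hτ : Complex.exp τ = q) (hN0 : N ≠ 0)
    (hC₁ : IsUnit C₁) (hC₂ : IsUnit C₂) (hlam : lam ≠ 0)
    (hsp : ∀ l : ℤ, resolventDen N (qpow τ (1 / N) ^ (-tri (N - 1)) • conjMatrix C₁ C₂)
      (qpow τ (1 / N) ^ l * lam) ≠ 0) (a b : Fin m₁ ⊕ Fin m₂) :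
    (∃ s, IsBorelLaplaceSum q τ N N lam (unip (formalGauge q N n₁ C₁ C₂ U) a b) s) ∧
      ∀ s, IsBorelLaplaceSum q τ N N lam (unip (formalGauge q N n₁ C₁ C₂ U) a b) s →
        ∀ w, w ≠ 0 → ∀ᶠ z in 𝓝[≠] w, s z = unip (summedGauge q τ N n₁ C₁ C₂ U lam z) a b := by
  have hconst {ι : Type} [DecidableEq ι] (i j : ι) : (1 : Matrix ι ι (PowerSeries ℂ)) i j =
      PowerSeries.C ((1 : Matrix ι ι ℂ) i j) := by
    rw [Matrix.one_apply, Matrix.one_apply]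
    split_ifs <;> simp
  rcases a with i | i <;> rcases b with j | j
  · simp only [unip, Matrix.fromBlocks_apply₁₁, hconst]
    exact isBorelLaplaceSum_C hq hτ hN0 hlam _
  · simp only [unip, Matrix.fromBlocks_apply₁₂]
    have hQ := isSpiralQuotient_resolvent hN0
      (isUnit_smul_conjMatrix hC₁ hC₂ (zpow_ne_zero (-tri (N - 1)) (qpow_ne_zero τ (1 / N))))
      (fun l => qpow τ (1 / N) ^ (-tri (l - 1)) • (gaugeCoeff q N n₁ C₁ C₂ U l).vec) hsp (j, i)
    have hF := isSumNearZero_resolvent hN0 (borel_gaugeCoeff_add hτ hN0) (j, i)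
      (coeff_qBorel_formalGauge (q := q) (τ := τ) (n₁ := n₁) (C₁ := C₁) (C₂ := C₂) (U := U) hN0 i j)
    exact ⟨⟨_, hQ.isBorelLaplaceSum hq hτ hN0 hlam hF⟩, fun s hs w hw =>
      hQ.eventuallyEq_of_isBorelLaplaceSum hq hτ hN0 hlam hF hs hw⟩
  · simp only [unip, Matrix.fromBlocks_apply₂₁, Matrix.zero_apply]
    have := isBorelLaplaceSum_C hq hτ hN0 hlam 0
    rwa [map_zero] at this
  · simp only [unip, Matrix.fromBlocks_apply₂₂, hconst]
    exact isBorelLaplaceSum_C hq hτ hN0 hlam _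

end Meromorphic

end QBorelLaplace

theorem theorem2p5 (q τ : ℂ) (hq : 1 < ‖q‖) (hτ : Complex.exp τ = q)
    (m₁ m₂ : ℕ) (n₁ n₂ : ℤ) (hn : n₁ < n₂)
    (C₁ : Matrix (Fin m₁) (Fin m₁) ℂ) (C₂ : Matrix (Fin m₂) (Fin m₂) ℂ)
    (hC₁ : IsUnit C₁) (hC₂ : IsUnit C₂)
    (U : ℤ → Matrix (Fin m₁) (Fin m₂) ℂ)
    (N : ℕ) (hN : (N : ℤ) = n₂ - n₁) :
    -- the exceptional set is finite
    (exceptionalSet q τ N C₁ C₂).Finite ∧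
    -- the formal gauge transformation with upper right block `H₁₂` exists and is unique
    ∃ H₁₂ : Matrix (Fin m₁) (Fin m₂) (PowerSeries ℂ),
      IsFormalGauge q n₁ n₂ C₁ C₂ U H₁₂ ∧
      (∀ H' : Matrix (Fin m₁) (Fin m₂) (PowerSeries ℂ),
        IsFormalGauge q n₁ n₂ C₁ C₂ U H' → H' = H₁₂) ∧
      ∀ lam : ℂˣ, (QuotientGroup.mk lam : ℂˣ ⧸ spiralGroup τ N) ∉ exceptionalSet q τ N C₁ C₂ →
        -- the Borel transforms of the entries of `H₁₂` lie in the space `ℍ`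
        (∀ i j, SeriesMemH q τ (N : ℚ) N (lam : ℂ) (qBorel τ (N : ℚ) (H₁₂ i j))) ∧
        -- the meromorphic gauge transformation with upper right block `X` exists, is unique,
        -- and is the Borel-Laplace sum of the formal one
        ∃ X : ℂ → Matrix (Fin m₁) (Fin m₂) ℂ,
          IsMeromorphicGauge q τ n₁ n₂ C₁ C₂ U N (lam : ℂ) X ∧
          (∀ X' : ℂ → Matrix (Fin m₁) (Fin m₂) ℂ,
            IsMeromorphicGauge q τ n₁ n₂ C₁ C₂ U N (lam : ℂ) X' → MeroEq X' X) ∧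
          (∃ S, IsMatrixBorelLaplaceSum q τ (N : ℚ) N (lam : ℂ) (unip H₁₂) S) ∧
          (∀ S, IsMatrixBorelLaplaceSum q τ (N : ℚ) N (lam : ℂ) (unip H₁₂) S →
            MeroEq S (fun z => unip (X z))) := by
  have hN0 : N ≠ 0 := by omega
  refine ⟨finite_exceptionalSet hτ hN0 C₁ C₂, formalGauge q N n₁ C₁ C₂ U,
    (isFormalGauge_iff_eq hN0 hN hC₁).mpr rfl, fun H' => (isFormalGauge_iff_eq hN0 hN hC₁).mp,
    fun lam hlam => ?_⟩
  -- The hypothesis `lam ∉ Σ` enters only here; both existence and uniqueness rest on this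
  -- nonvanishing.
  have hsp := resolventDen_conjMatrix_ne_zero hτ hN0 hC₁ hlam
  have hX := isMeromorphicGauge_summedGauge (U := U) hq hτ hN0 hN hC₁ hC₂ lam.ne_zero hsp
  have hS := isBorelLaplaceSum_unip (n₁ := n₁) (U := U) hq hτ hN0 hC₁ hC₂ lam.ne_zero hsp
  refine ⟨fun i j => ?_, _, hX, fun X' hX' =>
    meroEq_of_isMeromorphicGauge hq hτ hN0 hN hC₁ lam.ne_zero hsp hX' hX, ?_, fun S hSum w hw => ?_⟩
  · exact (isSpiralQuotient_resolvent hN0 (isUnit_smul_conjMatrix hC₁ hC₂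
      (zpow_ne_zero (-tri (N - 1)) (qpow_ne_zero τ (1 / N)))) _ hsp (j, i)).seriesMemH hq hτ hN0
      lam.ne_zero (isSumNearZero_resolvent hN0 (borel_gaugeCoeff_add hτ hN0) (j, i)
        (coeff_qBorel_formalGauge hN0 i j))
  · choose s hs using fun a b => (hS a b).1
    exact ⟨fun z => Matrix.of fun a b => s a b z, hs⟩
  · have h := eventually_all.mpr fun a => eventually_all.mpr fun b =>
      (hS a b).2 _ (hSum a b) w hw
    filter_upwards [h] with z hz
    ext a b
    exact hz a b
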